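/- All graphs are finite and simple. A graph $G$ is a cocomparability graph if there is a partial order on $V(G)$ such that two distinct vertices are non-adjacent in $G$ if and only if they are comparable. A graph $G$ is $B_0$-VPG if it is an intersection graph of horizontal and vertical line segments in the plane, that is, if each vertex $v$ can be assigned a closed horizontal or vertical line segment $S_v\subset\mathbb{R}^2$ so that distinct vertices $u,v$ are adjacent if and only if $S_u\cap S_v\neq\emptyset$. An edge $xy$ of $G$ is a diamond diagonal if $x$ and $y$ have two common neighbours that are not adjacent to each other (equivalently, $x,y$ are the two vertices of degree $3$ in an induced diamond, a $4$-cycle plus one chord, of $G$). Two vertices of $G$ are diamond related if there is a path in $G$ between them all of whose edges are diamond diagonals. Theorem. A cocomparability graph $G$ is $B_0$-VPG if and only if both of the following hold: (i) no two distinct vertices of an induced $4$-cycle $C_4$ of $G$ are diamond related; (ii) $G$ has no induced subgraph isomorphic to $\overline{C_6}$, the complement of the $6$-cycle. -/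

import Mathlib

namespace B0VPG

/-- `G` is the comparability graph of some partial order on its vertex set: two vertices are
adjacent exactly when they are distinct and comparable. -/
def IsComparabilityGraph {V : Type*} (G : SimpleGraph V) : Prop :=
  ∃ P : PartialOrder V, ∀ u v : V, G.Adj u v ↔ u ≠ v ∧ (P.le u v ∨ P.le v u)

/-- A cocomparability graph is the complement of a comparability graph. -/
def IsCocomparabilityGraph {V : Type*} (G : SimpleGraph V) : Prop :=
  IsComparabilityGraph Gᶜ

/-- A (closed, nondegenerate) horizontal line segment in the plane. -/
def IsHorizontalSegment (s : Set (ℝ × ℝ)) : Prop :=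
  ∃ a b y : ℝ, a < b ∧ s = Set.Icc a b ×ˢ {y}

/-- A (closed, nondegenerate) vertical line segment in the plane. -/
def IsVerticalSegment (s : Set (ℝ × ℝ)) : Prop :=
  ∃ x a b : ℝ, a < b ∧ s = {x} ×ˢ Set.Icc a b

/-- `G` is `B₀`-VPG: it is the intersection graph of a family of horizontal and vertical line
segments in the plane. Different vertices may be represented by overlapping or equal segments. -/
def IsB0VPG {V : Type*} (G : SimpleGraph V) : Prop :=
  ∃ S : V → Set (ℝ × ℝ),
    (∀ v, IsHorizontalSegment (S v) ∨ IsVerticalSegment (S v)) ∧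
    ∀ u v, u ≠ v → (G.Adj u v ↔ (S u ∩ S v).Nonempty)

/-- The diamond: the cycle `0, 1, 2, 3` together with the additional edge `02`. -/
def diamond : SimpleGraph (Fin 4) :=
  SimpleGraph.cycleGraph 4 ⊔ SimpleGraph.edge 0 2

/-- `xy` is a diamond diagonal of `G`: the additional edge of some induced diamond of `G`. -/
def IsDiamondDiagonal {V : Type*} (G : SimpleGraph V) (x y : V) : Prop :=
  ∃ f : diamond ↪g G, f 0 = x ∧ f 2 = y

/-- `x` and `y` are diamond related: some path of `G` from `x` to `y` uses only edges that are
diamond diagonals. -/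
def DiamondRelated {V : Type*} (G : SimpleGraph V) (x y : V) : Prop :=
  ∃ p : G.Walk x y, p.IsPath ∧ ∀ u v : V, s(u, v) ∈ p.edges → IsDiamondDiagonal G u v

end B0VPG

/-! Necessity is geometric. In a segment representation the sides of an induced 4-cycle alternate in
direction and its opposite sides lie on different parallel lines (`side`, `diagonal`), while the
ends of a diamond diagonal lie on one line (`IsSegmentRepresentation.diamond`). Diamond related
vertices are therefore collinear, and no two vertices of a 4-cycle are. The complement of the
6-cycle is a prism: each edge of its triangles is on an induced 4-cycle, so three vertices would
need pairwise different directions out of two.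

For sufficiency, fix a strict order `r` whose incomparability graph is `G`. The first task is to
choose directions so that diamond diagonals are parallel and sides of 4-cycles alternate
(`exists_orientation`). Edges with related ends are contracted one by one, for any equivalence
relation that contains the diamond diagonals and separates the vertices of each 4-cycle; this class
of relations, unlike diamond relatedness itself, is visibly stable under contraction. Once no
related edges are left there are no diamonds, and edges on no 4-cycle may be contracted as well. At
the end every edge is on a 4-cycle, and the absence of diamonds and prisms excludes triangles. The
order then has width at most two, and its two chains are the two directions.

The second task is to draw the graph. The components of equally directed vertices become lines,
ordered by `r`. Within a direction the order has no 2+2, so it is an interval order. Between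
perpendicular components the edges form a complete bipartite graph on the vertices with a neighbour
on the other side (`adj_of_touching`). A segment thus only has to cross the lines that its vertex
touches, and these are consecutive; the interval order decides the remaining ties among collinear
segments. -/

namespace B0VPG

-- Incomparability orders and explicit induced configurations

universe u
variable {V : Type u}

/-- `r` is a strict partial order whose incomparability graph is `G`. -/
structure IsIncomparabilityOrder (G : SimpleGraph V) (r : V → V → Prop) : Prop where
  irrefl : ∀ a, ¬ r a a
  trans : ∀ {a b c}, r a b → r b c → r a c
  adj_iff : ∀ a b, G.Adj a b ↔ a ≠ b ∧ ¬ r a b ∧ ¬ r b a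

/-- `a, b, c, d` is an induced `4`-cycle of `G`, in this cyclic order. -/
structure IsInducedC4 (G : SimpleGraph V) (a b c d : V) : Prop where
  ab : G.Adj a b
  bc : G.Adj b c
  cd : G.Adj c d
  da : G.Adj d a
  ne_ac : a ≠ c
  ne_bd : b ≠ d
  ac : ¬ G.Adj a c
  bd : ¬ G.Adj b d

/-- `p` and `q` are adjacent and `u`, `w` are distinct non-adjacent common neighbours. -/
structure IsInducedDiamond (G : SimpleGraph V) (p q u w : V) : Prop where
  pq : G.Adj p q
  pu : G.Adj p u
  pw : G.Adj p w
  qu : G.Adj q u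
  qw : G.Adj q w
  ne_uw : u ≠ w
  uw : ¬ G.Adj u w

/-- Two triangles `a₁ a₂ a₃` and `b₁ b₂ b₃` joined exactly by the edges `aᵢ bᵢ`. -/
structure IsInducedPrism (G : SimpleGraph V) (a₁ a₂ a₃ b₁ b₂ b₃ : V) : Prop where
  a₁a₂ : G.Adj a₁ a₂
  a₂a₃ : G.Adj a₂ a₃
  a₃a₁ : G.Adj a₃ a₁
  b₁b₂ : G.Adj b₁ b₂
  b₂b₃ : G.Adj b₂ b₃
  b₃b₁ : G.Adj b₃ b₁
  a₁b₁ : G.Adj a₁ b₁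
  a₂b₂ : G.Adj a₂ b₂
  a₃b₃ : G.Adj a₃ b₃
  ne₁₂ : a₁ ≠ b₂
  ne₁₃ : a₁ ≠ b₃
  ne₂₁ : a₂ ≠ b₁
  ne₂₃ : a₂ ≠ b₃
  ne₃₁ : a₃ ≠ b₁
  ne₃₂ : a₃ ≠ b₂
  a₁b₂ : ¬ G.Adj a₁ b₂
  a₁b₃ : ¬ G.Adj a₁ b₃
  a₂b₁ : ¬ G.Adj a₂ b₁
  a₂b₃ : ¬ G.Adj a₂ b₃
  a₃b₁ : ¬ G.Adj a₃ b₁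
  a₃b₂ : ¬ G.Adj a₃ b₂

variable {G : SimpleGraph V} {r : V → V → Prop}

namespace IsInducedC4

variable {a b c d : V}

theorem rotate (h : IsInducedC4 G a b c d) : IsInducedC4 G b c d a :=
  ⟨h.bc, h.cd, h.da, h.ab, h.ne_bd, h.ne_ac.symm, h.bd, fun k => h.ac k.symm⟩

theorem reflect (h : IsInducedC4 G a b c d) : IsInducedC4 G a d c b :=
  ⟨h.da.symm, h.cd.symm, h.bc.symm, h.ab.symm, h.ne_ac, h.ne_bd.symm, h.ac, fun k => h.bd k.symm⟩

end IsInducedC4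

namespace IsInducedPrism

variable {a₁ a₂ a₃ b₁ b₂ b₃ : V}

theorem rotate (h : IsInducedPrism G a₁ a₂ a₃ b₁ b₂ b₃) : IsInducedPrism G a₂ a₃ a₁ b₂ b₃ b₁ :=
  ⟨h.a₂a₃, h.a₃a₁, h.a₁a₂, h.b₂b₃, h.b₃b₁, h.b₁b₂, h.a₂b₂, h.a₃b₃, h.a₁b₁, h.ne₂₃, h.ne₂₁,
    h.ne₃₂, h.ne₃₁, h.ne₁₂, h.ne₁₃, h.a₂b₃, h.a₂b₁, h.a₃b₂, h.a₃b₁, h.a₁b₂, h.a₁b₃⟩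

theorem swap (h : IsInducedPrism G a₁ a₂ a₃ b₁ b₂ b₃) : IsInducedPrism G b₁ b₂ b₃ a₁ a₂ a₃ :=
  ⟨h.b₁b₂, h.b₂b₃, h.b₃b₁, h.a₁a₂, h.a₂a₃, h.a₃a₁, h.a₁b₁.symm, h.a₂b₂.symm, h.a₃b₃.symm,
    h.ne₂₁.symm, h.ne₃₁.symm, h.ne₁₂.symm, h.ne₃₂.symm, h.ne₁₃.symm, h.ne₂₃.symm,
    fun k => h.a₂b₁ k.symm, fun k => h.a₃b₁ k.symm, fun k => h.a₁b₂ k.symm,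
    fun k => h.a₃b₂ k.symm, fun k => h.a₁b₃ k.symm, fun k => h.a₂b₃ k.symm⟩

end IsInducedPrism

/-! ### Width two and the exclusion of triangles -/

namespace IsIncomparabilityOrder

theorem flip (hr : IsIncomparabilityOrder G r) : IsIncomparabilityOrder G (fun a b => r b a) :=
  ⟨hr.irrefl, fun h k => hr.trans k h, fun a b => by rw [hr.adj_iff]; tauto⟩

theorem trichotomy (hr : IsIncomparabilityOrder G r) {a b : V} (h : a ≠ b) (hn : ¬ G.Adj a b) :
    r a b ∨ r b a := by
  have := hr.adj_iff a b
  tauto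

theorem not_lt (hr : IsIncomparabilityOrder G r) {a b : V} (h : G.Adj a b) : ¬ r a b :=
  ((hr.adj_iff a b).1 h).2.1

theorem not_gt (hr : IsIncomparabilityOrder G r) {a b : V} (h : G.Adj a b) : ¬ r b a :=
  ((hr.adj_iff a b).1 h).2.2

/-- Incomparability graphs have no induced `5`-cycle. -/
theorem not_inducedC5 (hr : IsIncomparabilityOrder G r) {a b c d e : V} (ab : G.Adj a b)
    (bc : G.Adj b c) (cd : G.Adj c d) (de : G.Adj d e) (ea : G.Adj e a)
    (ac : ¬ G.Adj a c) (bd : ¬ G.Adj b d) (ce : ¬ G.Adj c e) (da : ¬ G.Adj d a)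
    (eb : ¬ G.Adj e b) : False := by
  have hac := hr.trichotomy (a := a) (b := c) (by rintro rfl; exact da cd.symm) ac
  have hbd := hr.trichotomy (a := b) (b := d) (by rintro rfl; exact da ab.symm) bd
  have hce := hr.trichotomy (a := c) (b := e) (by rintro rfl; exact ac ea.symm) ce
  have hda := hr.trichotomy (a := d) (b := a) (by rintro rfl; exact ac cd.symm) da
  have heb := hr.trichotomy (a := e) (b := b) (by rintro rfl; exact bd de.symm) eb
  have t := @hr.trans
  have h1 := hr.not_lt ab
  have h2 := hr.not_lt bc
  have h3 := hr.not_lt cd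
  have h4 := hr.not_lt de
  have h5 := hr.not_lt ea
  have h1 := hr.not_gt ab
  have h2 := hr.not_gt bc
  have h3 := hr.not_gt cd
  have h4 := hr.not_gt de
  have h5 := hr.not_gt ea
  grind

theorem exists_maximal (hr : IsIncomparabilityOrder G r) [Finite V] (p : V → Prop)
    (h : ∃ a, p a) : ∃ a, p a ∧ ∀ b, p b → ¬ r a b := by
  have : IsStrictOrder V (fun a b => r b a) :=
    { irrefl := hr.irrefl, trans := fun _ _ _ h k => hr.trans k h }
  obtain ⟨a, ha, hm⟩ := (Finite.wellFounded_of_trans_of_irrefl (fun a b => r b a)).has_min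
    {a | p a} h
  exact ⟨a, ha, hm⟩

/-- A poset of width at most two is the union of two chains. -/
theorem exists_coloring_of_no_triangle (hr : IsIncomparabilityOrder G r) [Finite V]
    (ht : ∀ a b c, G.Adj a b → G.Adj b c → ¬ G.Adj c a) :
    ∃ f : V → Bool, ∀ a b, G.Adj a b → f a ≠ f b := by
  classical
  suffices H : ∀ S : Finset V, ∃ f : V → Bool, ∀ a ∈ S, ∀ b ∈ S, G.Adj a b → f a ≠ f b by
    have := Fintype.ofFinite V
    obtain ⟨f, hf⟩ := H Finset.univ
    exact ⟨f, fun a b => hf a (Finset.mem_univ _) b (Finset.mem_univ _)⟩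
  intro S
  induction S using Finset.strongInduction with
  | H S ih =>
    rcases S.eq_empty_or_nonempty with rfl | hS
    · exact ⟨fun _ => true, by simp⟩
    obtain ⟨a, haS, ha⟩ := hr.exists_maximal (· ∈ S) hS
    obtain ⟨f, hf⟩ := ih (S.erase a) (Finset.erase_ssubset haS)
    simp only [Finset.mem_erase] at hf
    by_cases hE : ∃ z w, z ∈ S ∧ w ∈ S ∧ z ≠ a ∧ w ≠ a ∧ G.Adj z w
    · obtain ⟨z, w, hz, hw, hza, hwa, hzw⟩ := hE
      -- Only vertices with a neighbour in `S` other than `a` constrain the colouring, so the top of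
      -- each colour class is taken among these.
      have top : ∀ i : Bool, ∃ x, (x ∈ S ∧ x ≠ a ∧ f x = i ∧ ∃ w ∈ S, w ≠ a ∧ G.Adj x w) ∧
          ∀ y, (y ∈ S ∧ y ≠ a ∧ f y = i ∧ ∃ w ∈ S, w ≠ a ∧ G.Adj y w) → y = x ∨ r y x := by
        intro i
        obtain ⟨x, hx, hm⟩ := hr.exists_maximal
          (fun x => x ∈ S ∧ x ≠ a ∧ f x = i ∧ ∃ w ∈ S, w ≠ a ∧ G.Adj x w) (by
            have := hf z ⟨hza, hz⟩ w ⟨hwa, hw⟩ hzw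
            by_cases hi : f z = i
            · exact ⟨z, hz, hza, hi, w, hw, hwa, hzw⟩
            · refine ⟨w, hw, hwa, ?_, z, hz, hza, hzw.symm⟩
              revert this hi
              cases f z <;> cases f w <;> cases i <;> simp)
        refine ⟨x, hx, fun y hy => ?_⟩
        by_contra hc
        push Not at hc
        rcases hr.trichotomy (a := y) (b := x) hc.1 (fun h => hf y ⟨hy.2.1, hy.1⟩ x ⟨hx.2.1, hx.1⟩ h
          (hy.2.2.1.trans hx.2.2.1.symm)) with h | h
        · exact hc.2 h
        · exact hm y hy h
      have split : ∀ i x, (x ∈ S ∧ x ≠ a ∧ f x = i ∧ ∃ w ∈ S, w ≠ a ∧ G.Adj x w) →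
          (∀ y, (y ∈ S ∧ y ≠ a ∧ f y = i ∧ ∃ w ∈ S, w ≠ a ∧ G.Adj y w) → y = x ∨ r y x) →
          r x a → ∃ f : V → Bool, ∀ a ∈ S, ∀ b ∈ S, G.Adj a b → f a ≠ f b := by
        intro i x hx hm hxa
        -- The new chain is `a` on top of the part of class `i` up to `x`. The vertices of class `i`
        -- outside this part have no neighbour except possibly `a`, so they can join the other
        -- class.
        refine ⟨fun z => decide (z = a ∨ f z = i ∧ (z = x ∨ r z x)), ?_⟩
        have key : ∀ z, z = x ∨ r z x → r z a := by
          rintro z (rfl | h)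
          · exact hxa
          · exact hr.trans h hxa
        intro u hu v hv huv h
        have huv' : ¬ r u v ∧ ¬ r v u := ⟨hr.not_lt huv, hr.not_gt huv⟩
        have h3 := huv.ne
        rw [decide_eq_decide] at h
        by_cases hua : u = a
        · subst hua
          have := key v
          grind
        by_cases hva : v = a
        · subst hva
          have := key u
          grind
        have h4 := hf u ⟨hua, hu⟩ v ⟨hva, hv⟩ huv
        have h5 := fun k => hm u ⟨hu, hua, k, v, hv, hva, huv⟩
        have h6 := fun k => hm v ⟨hv, hva, k, u, hu, hua, huv.symm⟩
        clear hm hf ih ht top key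
        revert h h4 h5 h6
        cases f u <;> cases f v <;> cases i <;> simp [hua, hva]
      obtain ⟨x, hx, hxm⟩ := top true
      obtain ⟨y, hy, hym⟩ := top false
      by_cases hxa : r x a
      · exact split true x hx hxm hxa
      by_cases hya : r y a
      · exact split false y hy hym hya
      exfalso
      have hax : G.Adj a x := (hr.adj_iff _ _).2 ⟨hx.2.1.symm, ha x hx.1, hxa⟩
      have hay : G.Adj y a := (hr.adj_iff _ _).2 ⟨hy.2.1, hya, ha y hy.1⟩
      -- The tops `x` and `y` are incomparable: a neighbour of `x` is at most `y`, so `y` below `x`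
      -- would put it below `x`; and symmetrically. Hence `a`, `x`, `y` is a triangle.
      refine ht a x y hax ?_ hay
      obtain ⟨hxS, hxa', hfx, w₁, hw₁, hw₁a, hxw⟩ := hx
      obtain ⟨hyS, hya', hfy, w₂, hw₂, hw₂a, hyw⟩ := hy
      have h1 := hxm w₂ ⟨hw₂, hw₂a, by
        have := hf y ⟨hya', hyS⟩ w₂ ⟨hw₂a, hw₂⟩ hyw
        revert this; rw [hfy]; cases f w₂ <;> simp, y, hyS, hya', hyw.symm⟩
      have h2 := hym w₁ ⟨hw₁, hw₁a, by
        have := hf x ⟨hxa', hxS⟩ w₁ ⟨hw₁a, hw₁⟩ hxw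
        revert this; rw [hfx]; cases f w₁ <;> simp, x, hxS, hxa', hxw.symm⟩
      rw [hr.adj_iff]
      have t := @hr.trans
      have a1 := hr.not_lt hxw
      have a2 := hr.not_gt hxw
      have a3 := hr.not_lt hyw
      have a4 := hr.not_gt hyw
      refine ⟨by rintro rfl; simp_all, fun h => ?_, fun h => ?_⟩
      · rcases h1 with rfl | h1
        · exact a4 h
        · exact a4 (t h1 h)
      · rcases h2 with rfl | h2
        · exact a2 h
        · exact a2 (t h2 h)
    · refine ⟨fun z => decide (z = a), fun u hu v hv huv h => ?_⟩
      rw [decide_eq_decide] at h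
      have := huv.ne
      push Not at hE
      have := hE u v hu hv
      grind

/-- If `G` contains no diamond and every edge is on an induced `4`-cycle, then an edge `ab` of a
triangle `abx` has its ends in private cliques on a common side of the triangle. -/
theorem exists_external (hr : IsIncomparabilityOrder G r)
    (hd : ∀ p q u w, ¬ IsInducedDiamond G p q u w) {a b x : V}
    (hab : G.Adj a b) (hbx : G.Adj b x) (hxa : G.Adj x a)
    (h : ∃ c d, IsInducedC4 G a b c d) :
    ((∃ d, G.Adj d a ∧ r b d ∧ r x d) ∧ (∃ c, G.Adj c b ∧ r a c ∧ r x c)) ∨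
    ((∃ d, G.Adj d a ∧ r d b ∧ r d x) ∧ (∃ c, G.Adj c b ∧ r c a ∧ r c x)) := by
  obtain ⟨c, d, h⟩ := h
  have cx : ¬ G.Adj x c := fun k => hd b x a c ⟨hbx, hab.symm, h.bc, hxa, k, h.ne_ac, h.ac⟩
  have dx : ¬ G.Adj x d := fun k =>
    hd a x b d ⟨hxa.symm, hab, h.da.symm, hbx.symm, k, h.ne_bd, h.bd⟩
  -- Since `x` is incomparable to `a` and `b`, it is on the same side of `c` as `a` and on the same
  -- side of `d` as `b`. If `c` and `d` were on opposite sides, `x` would lie between them, although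
  -- they are adjacent.
  have h1 := hr.trichotomy h.ne_ac h.ac
  have h2 := hr.trichotomy h.ne_bd h.bd
  have h3 := hr.trichotomy (by rintro rfl; exact h.ac hxa.symm) cx
  have h4 := hr.trichotomy (by rintro rfl; exact h.bd hbx) dx
  have t := @hr.trans
  have n := @hr.not_lt
  have n' := @hr.not_gt
  have i1 := n hxa
  have i2 := n' hxa
  have i3 := n hbx
  have i4 := n' hbx
  have i5 := n h.cd
  have i6 := n' h.cd
  have e1 := h.da
  have e2 := h.bc.symm
  grind

/-- The three private neighbours are pairwise incomparable: if `d` were below `c`, then `b` would be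
below `c` too, against their adjacency. -/
theorem exists_prism (hr : IsIncomparabilityOrder G r) {a b x d c e : V}
    (hab : G.Adj a b) (hbx : G.Adj b x) (hxa : G.Adj x a)
    (hd : G.Adj d a ∧ r b d ∧ r x d) (hc : G.Adj c b ∧ r a c ∧ r x c)
    (he : G.Adj e x ∧ r a e ∧ r b e) : IsInducedPrism G a b x d c e := by
  have t := @hr.trans
  have n := @hr.not_lt
  have ad := hr.adj_iff
  have n' := @hr.not_gt
  obtain ⟨hd1, hd2, hd3⟩ := hd
  obtain ⟨hc1, hc2, hc3⟩ := hc
  obtain ⟨he1, he2, he3⟩ := he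
  have i1 := n hd1
  have i2 := n' hd1
  have i3 := n hc1
  have i4 := n' hc1
  have i5 := n he1
  have i6 := n' he1
  have ir := hr.irrefl
  constructor
  all_goals first
    | assumption
    | (apply SimpleGraph.Adj.symm; assumption)
    | (rintro rfl; exact ir _ ‹_›)
    | (intro k; exact n k ‹_›)
    | (rw [ad]; grind)

/-- Each edge of a triangle chooses a side, up or down, on which both its ends have private
neighbours. Two of the three edges agree and together cover all three vertices, which yields a
prism. -/
theorem no_triangle (hr : IsIncomparabilityOrder G r)
    (hd : ∀ p q u w, ¬ IsInducedDiamond G p q u w)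
    (hp : ∀ a₁ a₂ a₃ b₁ b₂ b₃, ¬ IsInducedPrism G a₁ a₂ a₃ b₁ b₂ b₃)
    (h4 : ∀ a b, G.Adj a b → ∃ c d, IsInducedC4 G a b c d) {a b x : V}
    (hab : G.Adj a b) (hbx : G.Adj b x) : ¬ G.Adj x a := by
  intro hxa
  have h1 := hr.exists_external hd hab hbx hxa (h4 _ _ hab)
  have h2 := hr.exists_external hd hbx hxa hab (h4 _ _ hbx)
  have h3 := hr.exists_external hd hxa hab hbx (h4 _ _ hxa)
  have up : ¬ ((∃ d, G.Adj d a ∧ r b d ∧ r x d) ∧ (∃ c, G.Adj c b ∧ r a c ∧ r x c) ∧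
      ∃ e, G.Adj e x ∧ r a e ∧ r b e) := by
    rintro ⟨⟨d, hd⟩, ⟨c, hc⟩, e, he⟩
    exact hp _ _ _ _ _ _ (hr.exists_prism hab hbx hxa hd hc he)
  have dn : ¬ ((∃ d, G.Adj d a ∧ r d b ∧ r d x) ∧ (∃ c, G.Adj c b ∧ r c a ∧ r c x) ∧
      ∃ e, G.Adj e x ∧ r e a ∧ r e b) := by
    rintro ⟨⟨d, hd⟩, ⟨c, hc⟩, e, he⟩
    exact hp _ _ _ _ _ _ (hr.flip.exists_prism hab hbx hxa hd hc he)
  grind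

end IsIncomparabilityOrder
-- Lifting induced configurations through an edge contraction
/-- The graph obtained from `G` by contracting `y` into `x`. -/
def contract (G : SimpleGraph V) (x y : V) : SimpleGraph {v : V // v ≠ y} where
  Adj u w := u ≠ w ∧ (G.Adj u w ∨ (u.1 = x ∧ G.Adj y w) ∨ (w.1 = x ∧ G.Adj u y))
  symm := ⟨fun u w h => ⟨h.1.symm, by
    rcases h.2 with h | h | h
    · exact Or.inl h.symm
    · exact Or.inr (Or.inr ⟨h.1, h.2.symm⟩)
    · exact Or.inr (Or.inl ⟨h.1, h.2.symm⟩)⟩⟩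
  loopless := ⟨fun _ h => h.1 rfl⟩

theorem contract_adj {x y : V} {u w : {v : V // v ≠ y}} : (contract G x y).Adj u w ↔
    u.1 ≠ w.1 ∧ (G.Adj u w ∨ (u.1 = x ∧ G.Adj y w) ∨ (w.1 = x ∧ G.Adj u y)) := by
  simp only [contract, ne_eq, Subtype.ext_iff]

/-- The merged vertex is below another when both `x` and `y` are. No vertex lies between the
incomparable `x` and `y`, so a vertex comparable to both is on the same side of both. -/
theorem contract_isIncomparabilityOrder (hr : IsIncomparabilityOrder G r) {x y : V}
    (hxy : G.Adj x y) : IsIncomparabilityOrder (contract G x y)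
      (fun u w => r u w ∧ (u.1 = x → r y w) ∧ (w.1 = x → r u y)) := by
  have n := hr.not_lt hxy
  have n' := hr.not_gt hxy
  refine ⟨fun a h => hr.irrefl _ h.1, ?_, ?_⟩
  · rintro a b c ⟨h1, h2, h3⟩ ⟨k1, k2, k3⟩
    exact ⟨hr.trans h1 k1, fun h => hr.trans (h2 h) k1, fun h => hr.trans h1 (k3 h)⟩
  · rintro ⟨a, ha⟩ ⟨b, hb⟩
    rw [contract_adj]
    simp only [ne_eq, Subtype.mk.injEq, hr.adj_iff]
    have t := @hr.trans
    have := hxy.ne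
    by_cases hax : a = x
    · subst hax
      have t1 := @t a b y
      have t2 := @t y b a
      grind
    · by_cases hbx : b = x
      · subst hbx
        have t1 := @t b a y
        have t2 := @t y a b
        grind
      · grind

section

variable {x y : V}

/-- If neither `x` nor `y` is adjacent to both `b` and `d`, then `x`, `y`, `b`, `c`, `d` span an
induced 5-cycle. -/
theorem IsInducedC4.of_contract_of_eq (hr : IsIncomparabilityOrder G r) (hxy : G.Adj x y)
    {a b c d : {v : V // v ≠ y}} (h : IsInducedC4 (contract G x y) a b c d) (hx : a.1 = x) :
    IsInducedC4 G x b c d ∨ IsInducedC4 G y b c d := by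
  obtain ⟨a, ha⟩ := a
  obtain ⟨b, hb⟩ := b
  obtain ⟨c, hc⟩ := c
  obtain ⟨d, hd⟩ := d
  obtain ⟨h1, h2, h3, h4, h5, h6, h7, h8⟩ := h
  have n5 : a ≠ c := fun k => h5 (Subtype.ext k)
  have n6 : b ≠ d := fun k => h6 (Subtype.ext k)
  simp only [contract_adj, ne_eq, Subtype.mk.injEq] at h1 h2 h3 h4 h5 h6 h7 h8 hx
  subst hx
  have e1 : b ≠ a := fun k => h1.1 k.symm
  have e2 : c ≠ a := fun k => h5 k.symm
  have e3 : d ≠ a := h4.1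
  simp only [e1, e2, e3, false_and, or_false, true_and, false_or, h1.1, h2.1, h3.1, h5, h6,
    not_false_eq_true] at h1 h2 h3 h4 h7 h8
  push Not at h7
  have key : ∀ b d, G.Adj a b → G.Adj y d → ¬ G.Adj a d → ¬ G.Adj y b → ¬ G.Adj b d →
      G.Adj b c → G.Adj c d → False := fun b d k1 k2 k3 k4 k5 k6 k7 =>
    hr.not_inducedC5 hxy k2 k7.symm k6.symm k1.symm k3 h7.2 (fun h => k5 h.symm)
      (fun h => h7.1 h.symm) (fun h => k4 h.symm)
  by_cases hab : G.Adj a b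
  · by_cases hda : G.Adj d a
    · exact Or.inl ⟨hab, h2, h3, hda, n5, n6, h7.1, h8⟩
    · have hdy : G.Adj d y := h4.resolve_left hda
      by_cases hyb : G.Adj y b
      · exact Or.inr ⟨hyb, h2, h3, hdy, fun k => hc k.symm, n6, h7.2, h8⟩
      · exact (key b d hab hdy.symm (fun h => hda h.symm) hyb h8 h2 h3).elim
  · have hyb : G.Adj y b := h1.resolve_left hab
    by_cases hdy : G.Adj d y
    · exact Or.inr ⟨hyb, h2, h3, hdy, fun k => hc k.symm, n6, h7.2, h8⟩
    · have hda : G.Adj d a := h4.resolve_right hdy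
      exact (key d b hda.symm hyb hab (fun h => hdy h.symm) (fun h => h8 h.symm) h3.symm
        h2.symm).elim

theorem IsInducedC4.of_contract_of_ne {a b c d : {v : V // v ≠ y}}
    (h : IsInducedC4 (contract G x y) a b c d) (ha : a.1 ≠ x) (hb : b.1 ≠ x) (hc : c.1 ≠ x)
    (hd : d.1 ≠ x) : IsInducedC4 G a b c d := by
  obtain ⟨h1, h2, h3, h4, h5, h6, h7, h8⟩ := h
  simp only [contract_adj, ha, hb, hc, hd, false_and, or_false, Subtype.ext_iff, ne_eq] at *
  exact ⟨h1.2, h2.2, h3.2, h4.2, h5, h6, fun h => h7 ⟨h5, h⟩, fun h => h8 ⟨h6, h⟩⟩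

/-- An induced `4`-cycle of the contraction lifts to one of `G`. -/
theorem IsInducedC4.of_contract (hr : IsIncomparabilityOrder G r) (hxy : G.Adj x y)
    {a b c d : {v : V // v ≠ y}} (h : IsInducedC4 (contract G x y) a b c d) :
    ∃ a' b' c' d', IsInducedC4 G a' b' c' d' ∧ (a' = a ∨ (a.1 = x ∧ a' = y)) ∧
      (b' = b ∨ (b.1 = x ∧ b' = y)) ∧ (c' = c ∨ (c.1 = x ∧ c' = y)) ∧
      (d' = d ∨ (d.1 = x ∧ d' = y)) := by
  by_cases ha : a.1 = x
  · rcases h.of_contract_of_eq hr hxy ha with k | k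
    · exact ⟨_, _, _, _, k, by simp [ha]⟩
    · exact ⟨_, _, _, _, k, by simp [ha]⟩
  by_cases hb : b.1 = x
  · rcases h.rotate.of_contract_of_eq hr hxy hb with k | k
    · exact ⟨_, _, _, _, k.rotate.rotate.rotate, by simp [hb]⟩
    · exact ⟨_, _, _, _, k.rotate.rotate.rotate, by simp [hb]⟩
  by_cases hc : c.1 = x
  · rcases h.rotate.rotate.of_contract_of_eq hr hxy hc with k | k
    · exact ⟨_, _, _, _, k.rotate.rotate, by simp [hc]⟩
    · exact ⟨_, _, _, _, k.rotate.rotate, by simp [hc]⟩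
  by_cases hd : d.1 = x
  · rcases h.rotate.rotate.rotate.of_contract_of_eq hr hxy hd with k | k
    · exact ⟨_, _, _, _, k.rotate, by simp [hd]⟩
    · exact ⟨_, _, _, _, k.rotate, by simp [hd]⟩
  exact ⟨_, _, _, _, h.of_contract_of_ne ha hb hc hd, by simp⟩

/-- An edge that lies on an induced `4`-cycle. -/
def IsC4Edge (G : SimpleGraph V) (a b : V) : Prop := ∃ c d, IsInducedC4 G a b c d

/-- The two 4-cycles through `a₁` lift separately. If one lifts only to `x` and the other only to
`y`, then `x`, `y`, `a₂`, `a₃` span a 4-cycle that contains the edge `xy`. -/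
theorem IsInducedPrism.of_contract_of_eq (hxy : G.Adj x y) (hC : ¬ IsC4Edge G x y)
    (hr : IsIncomparabilityOrder G r)
    {a₁ a₂ a₃ b₁ b₂ b₃ : {v : V // v ≠ y}}
    (h : IsInducedPrism (contract G x y) a₁ a₂ a₃ b₁ b₂ b₃) (hx : a₁.1 = x) :
    IsInducedPrism G x a₂ a₃ b₁ b₂ b₃ ∨ IsInducedPrism G y a₂ a₃ b₁ b₂ b₃ := by
  have c1 : IsInducedC4 (contract G x y) a₁ a₂ b₂ b₁ :=
    ⟨h.a₁a₂, h.a₂b₂, h.b₁b₂.symm, h.a₁b₁.symm, h.ne₁₂, h.ne₂₁, h.a₁b₂, h.a₂b₁⟩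
  have c2 : IsInducedC4 (contract G x y) a₁ a₃ b₃ b₁ :=
    ⟨h.a₃a₁.symm, h.a₃b₃, h.b₃b₁, h.a₁b₁.symm, h.ne₁₃, h.ne₃₁, h.a₁b₃, h.a₃b₁⟩
  have n2 : a₂.1 ≠ x := by rw [← hx]; exact fun k => h.a₁a₂.ne (Subtype.ext k.symm)
  have n3 : a₃.1 ≠ x := by rw [← hx]; exact fun k => h.a₃a₁.ne (Subtype.ext k)
  have m1 : b₁.1 ≠ x := by rw [← hx]; exact fun k => h.a₁b₁.ne (Subtype.ext k.symm)
  have m2 : b₂.1 ≠ x := by rw [← hx]; exact fun k => h.ne₁₂ (Subtype.ext k.symm)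
  have m3 : b₃.1 ≠ x := by rw [← hx]; exact fun k => h.ne₁₃ (Subtype.ext k.symm)
  have tr : ∀ {u w : {v : V // v ≠ y}}, u.1 ≠ x → w.1 ≠ x →
      ((contract G x y).Adj u w ↔ G.Adj u w) := by
    intro u w hu hw
    rw [contract_adj]
    simp only [hu, hw, false_and, or_false, and_iff_right_iff_imp]
    exact fun k => k.ne
  have ne : ∀ {u w : {v : V // v ≠ y}}, u ≠ w → u.1 ≠ w.1 := fun h k => h (Subtype.ext k)
  have lift : ∀ z, IsInducedC4 G z a₂ b₂ b₁ → IsInducedC4 G z a₃ b₃ b₁ →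
      IsInducedPrism G z a₂ a₃ b₁ b₂ b₃ := fun z k1 k2 =>
    ⟨k1.ab, (tr n2 n3).1 h.a₂a₃, k2.ab.symm, (tr m1 m2).1 h.b₁b₂, (tr m2 m3).1 h.b₂b₃,
      (tr m3 m1).1 h.b₃b₁, k1.da.symm, (tr n2 m2).1 h.a₂b₂, (tr n3 m3).1 h.a₃b₃, k1.ne_ac, k2.ne_ac,
      ne h.ne₂₁, ne h.ne₂₃, ne h.ne₃₁, ne h.ne₃₂, k1.ac, k2.ac, fun k => h.a₂b₁ ((tr n2 m1).2 k),
      fun k => h.a₂b₃ ((tr n2 m3).2 k), fun k => h.a₃b₁ ((tr n3 m1).2 k),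
      fun k => h.a₃b₂ ((tr n3 m2).2 k)⟩
  have h23 : G.Adj a₂ a₃ := (tr n2 n3).1 h.a₂a₃
  have nb2 : ¬ G.Adj x b₂ ∧ ¬ G.Adj y b₂ := by
    have := h.a₁b₂
    rw [contract_adj] at this
    have hn := ne h.ne₁₂
    rw [hx] at this hn
    simp only [ne_eq, hn, not_false_eq_true, true_and, m2, false_and, or_false] at this
    tauto
  have nb3 : ¬ G.Adj x b₃ ∧ ¬ G.Adj y b₃ := by
    have := h.a₁b₃
    rw [contract_adj] at this
    have hn := ne h.ne₁₃
    rw [hx] at this hn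
    simp only [ne_eq, hn, not_false_eq_true, true_and, m3, false_and, or_false] at this
    tauto
  rcases c1.of_contract_of_eq hr hxy hx with k1 | k1 <;>
    rcases c2.of_contract_of_eq hr hxy hx with k2 | k2
  · exact Or.inl (lift _ k1 k2)
  · by_cases e1 : G.Adj x a₃
    · exact Or.inl (lift _ k1 ⟨e1, k2.bc, k2.cd, k1.da, m3.symm, k2.ne_bd, nb3.1, k2.bd⟩)
    by_cases e2 : G.Adj y a₂
    · exact Or.inr (lift _ ⟨e2, k1.bc, k1.cd, k2.da, b₂.2.symm, k1.ne_bd, nb2.2, k1.bd⟩ k2)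
    exact (hC ⟨a₃, a₂, hxy, k2.ab, h23.symm, k1.ab.symm, n3.symm, a₂.2.symm, e1, e2⟩).elim
  · by_cases e1 : G.Adj x a₂
    · exact Or.inl (lift _ ⟨e1, k1.bc, k1.cd, k2.da, m2.symm, k1.ne_bd, nb2.1, k1.bd⟩ k2)
    by_cases e2 : G.Adj y a₃
    · exact Or.inr (lift _ k1 ⟨e2, k2.bc, k2.cd, k1.da, b₃.2.symm, k2.ne_bd, nb3.2, k2.bd⟩)
    exact (hC ⟨a₂, a₃, hxy, k1.ab, h23, k2.ab.symm, n2.symm, a₃.2.symm, e1, e2⟩).elim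
  · exact Or.inr (lift _ k1 k2)

/-- An induced prism of the contraction of an edge on no induced `4`-cycle gives one of `G`. -/
theorem IsInducedPrism.of_contract (hxy : G.Adj x y) (hC : ¬ IsC4Edge G x y)
    (hr : IsIncomparabilityOrder G r)
    {a₁ a₂ a₃ b₁ b₂ b₃ : {v : V // v ≠ y}}
    (h : IsInducedPrism (contract G x y) a₁ a₂ a₃ b₁ b₂ b₃) :
    ∃ a₁ a₂ a₃ b₁ b₂ b₃, IsInducedPrism G a₁ a₂ a₃ b₁ b₂ b₃ := by
  by_cases e1 : a₁.1 = x
  · rcases h.of_contract_of_eq hxy hC hr e1 with k | k <;> exact ⟨_, _, _, _, _, _, k⟩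
  by_cases e2 : a₂.1 = x
  · rcases h.rotate.of_contract_of_eq hxy hC hr e2 with k | k <;> exact ⟨_, _, _, _, _, _, k⟩
  by_cases e3 : a₃.1 = x
  · rcases h.rotate.rotate.of_contract_of_eq hxy hC hr e3 with k | k <;>
      exact ⟨_, _, _, _, _, _, k⟩
  by_cases f1 : b₁.1 = x
  · rcases h.swap.of_contract_of_eq hxy hC hr f1 with k | k <;> exact ⟨_, _, _, _, _, _, k⟩
  by_cases f2 : b₂.1 = x
  · rcases h.swap.rotate.of_contract_of_eq hxy hC hr f2 with k | k <;>
      exact ⟨_, _, _, _, _, _, k⟩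
  by_cases f3 : b₃.1 = x
  · rcases h.swap.rotate.rotate.of_contract_of_eq hxy hC hr f3 with k | k <;>
      exact ⟨_, _, _, _, _, _, k⟩
  refine ⟨a₁, a₂, a₃, b₁, b₂, b₃, ?_⟩
  obtain ⟨h1, h2, h3, h4, h5, h6, h7, h8, h9, n1, n2, n3, n4, n5, n6, m1, m2, m3, m4, m5, m6⟩ := h
  simp only [contract_adj, e1, e2, e3, f1, f2, f3, false_and, or_false, Subtype.ext_iff,
    ne_eq] at *
  exact ⟨h1.2, h2.2, h3.2, h4.2, h5.2, h6.2, h7.2, h8.2, h9.2, n1, n2, n3, n4, n5, n6,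
    fun h => m1 ⟨n1, h⟩, fun h => m2 ⟨n2, h⟩, fun h => m3 ⟨n3, h⟩, fun h => m4 ⟨n4, h⟩,
    fun h => m5 ⟨n5, h⟩, fun h => m6 ⟨n6, h⟩⟩

/-- If `q` is adjacent to just one of `x` and `y`, so are `u` and `w` to that one, or `xy` would be
on a 4-cycle. If `q` is adjacent to both, the other end of `xy` may have to replace `u` or `w`; only
the diagonal matters later. -/
theorem IsInducedDiamond.of_contract_of_eq_left (hxy : G.Adj x y) (hC : ¬ IsC4Edge G x y)
    {p q u w : {v : V // v ≠ y}} (h : IsInducedDiamond (contract G x y) p q u w) (hx : p.1 = x) :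
    ∃ p' u' w', IsInducedDiamond G p' q u' w' ∧ (p' = x ∨ p' = y) := by
  obtain ⟨p, hp⟩ := p
  obtain ⟨q, hq⟩ := q
  obtain ⟨u, hu⟩ := u
  obtain ⟨w, hw⟩ := w
  have key : ∀ s t, s ≠ y → t ≠ x → G.Adj x s → G.Adj y t → G.Adj s t → G.Adj y s ∨ G.Adj x t := by
    intro s t h1 h2 h3 h4 h5
    by_contra hc
    push Not at hc
    exact hC ⟨t, s, hxy, h4, h5.symm, h3.symm, h2.symm, h1.symm, hc.2, hc.1⟩
  obtain ⟨h1, h2, h3, h4, h5, h6, h7⟩ := h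
  have n6 : u ≠ w := fun k => h6 (Subtype.ext k)
  simp only [contract_adj] at h1 h2 h3 h4 h5 h7 hx ⊢
  subst hx
  have e1 : q ≠ p := fun k => h1.1 k.symm
  have e2 : u ≠ p := fun k => h2.1 k.symm
  have e3 : w ≠ p := fun k => h3.1 k.symm
  have hu' : u ≠ y := hu
  simp only [e1, e2, e3, false_and, or_false, true_and, n6, not_false_eq_true, ne_eq] at h1 h2 h3 h4 h5 h7
  have hqu := h4.2
  have hqw := h5.2
  have sqp := fun z => G.adj_comm z p
  have sqy := fun z => G.adj_comm z y
  by_cases q1 : G.Adj p q <;> by_cases q2 : G.Adj y q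
  · by_cases u1 : G.Adj p u <;> by_cases w1 : G.Adj p w
    · exact ⟨p, u, w, ⟨q1, u1, w1, hqu, hqw, n6, h7⟩, Or.inl rfl⟩
    · exact ⟨y, p, w, ⟨q2, hxy.symm, h3.2.resolve_left w1, q1.symm, hqw, e3.symm, w1⟩, Or.inr rfl⟩
    · exact ⟨y, p, u, ⟨q2, hxy.symm, h2.2.resolve_left u1, q1.symm, hqu, e2.symm, u1⟩, Or.inr rfl⟩
    · exact ⟨y, u, w, ⟨q2, h2.2.resolve_left u1, h3.2.resolve_left w1, hqu, hqw, n6, h7⟩,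
        Or.inr rfl⟩
  · refine ⟨p, u, w, ⟨q1, ?_, ?_, hqu, hqw, n6, h7⟩, Or.inl rfl⟩
    · exact h2.2.elim id fun k => (key q u hq e2 q1 k hqu).resolve_left q2
    · exact h3.2.elim id fun k => (key q w hq e3 q1 k hqw).resolve_left q2
  · refine ⟨y, u, w, ⟨q2, ?_, ?_, hqu, hqw, n6, h7⟩, Or.inr rfl⟩
    · exact h2.2.elim (fun k => (key u q hu e1 k q2 hqu.symm).resolve_right q1) id
    · exact h3.2.elim (fun k => (key w q hw e1 k q2 hqw.symm).resolve_right q1) id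
  · exact absurd h1.2 (by tauto)

theorem IsInducedDiamond.of_contract_of_eq_right (hxy : G.Adj x y) (hC : ¬ IsC4Edge G x y)
    {p q u w : {v : V // v ≠ y}} (h : IsInducedDiamond (contract G x y) p q u w) (hx : u.1 = x) :
    ∃ u', IsInducedDiamond G p q u' w := by
  obtain ⟨p, hp⟩ := p
  obtain ⟨q, hq⟩ := q
  obtain ⟨u, hu⟩ := u
  obtain ⟨w, hw⟩ := w
  obtain ⟨h1, h2, h3, h4, h5, h6, h7⟩ := h
  have n6 : u ≠ w := fun k => h6 (Subtype.ext k)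
  simp only [contract_adj] at h1 h2 h3 h4 h5 h7 hx ⊢
  subst hx
  have e1 : p ≠ u := h2.1
  have e2 : q ≠ u := h4.1
  have e3 : w ≠ u := n6.symm
  simp only [e1, e2, e3, false_and, or_false, true_and, false_or, n6, not_false_eq_true, ne_eq,
    not_or] at h1 h2 h3 h4 h5 h7
  by_cases p1 : G.Adj p u <;> by_cases q1 : G.Adj q u
  · exact ⟨u, h1.2, p1, h3.2, q1, h5.2, n6, h7.1⟩
  · have q2 := h4.resolve_left q1
    by_cases p2 : G.Adj p y
    · exact ⟨y, h1.2, p2, h3.2, q2, h5.2, hw.symm, h7.2⟩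
    · exact (hC ⟨q, p, hxy, q2.symm, h1.2.symm, p1, e2.symm, hp.symm,
        fun k => q1 k.symm, fun k => p2 k.symm⟩).elim
  · have p2 := h2.resolve_left p1
    by_cases q2 : G.Adj q y
    · exact ⟨y, h1.2, p2, h3.2, q2, h5.2, hw.symm, h7.2⟩
    · exact (hC ⟨p, q, hxy, p2.symm, h1.2, q1, e1.symm, hq.symm,
        fun k => p1 k.symm, fun k => q2 k.symm⟩).elim
  · exact ⟨y, h1.2, h2.resolve_left p1, h3.2, h4.resolve_left q1, h5.2, hw.symm, h7.2⟩

theorem IsInducedDiamond.swap {p q u w : V} (h : IsInducedDiamond G p q u w) :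
    IsInducedDiamond G q p u w :=
  ⟨h.pq.symm, h.qu, h.qw, h.pu, h.pw, h.ne_uw, h.uw⟩

theorem IsInducedDiamond.swap' {p q u w : V} (h : IsInducedDiamond G p q u w) :
    IsInducedDiamond G p q w u :=
  ⟨h.pq, h.pw, h.pu, h.qw, h.qu, h.ne_uw.symm, fun k => h.uw k.symm⟩

/-- A diamond of the contraction of an edge on no induced `4`-cycle gives a diamond of `G` whose
diagonal is contracted to the given one. -/
theorem IsInducedDiamond.of_contract (hxy : G.Adj x y) (hC : ¬ IsC4Edge G x y)
    {p q u w : {v : V // v ≠ y}} (h : IsInducedDiamond (contract G x y) p q u w) :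
    ∃ p' q' u' w', IsInducedDiamond G p' q' u' w' ∧ (p' = p ∨ (p.1 = x ∧ p' = y)) ∧
      (q' = q ∨ (q.1 = x ∧ q' = y)) := by
  by_cases e1 : p.1 = x
  · obtain ⟨p', u', w', k, k'⟩ := h.of_contract_of_eq_left hxy hC e1
    exact ⟨p', q, u', w', k, by simpa [e1] using k', by simp⟩
  by_cases e2 : q.1 = x
  · obtain ⟨q', u', w', k, k'⟩ := h.swap.of_contract_of_eq_left hxy hC e2
    exact ⟨p, q', u', w', k.swap, by simp, by simpa [e2] using k'⟩
  by_cases e3 : u.1 = x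
  · obtain ⟨u', k⟩ := h.of_contract_of_eq_right hxy hC e3
    exact ⟨_, _, _, _, k, by simp⟩
  by_cases e4 : w.1 = x
  · obtain ⟨u', k⟩ := h.swap'.of_contract_of_eq_right hxy hC e4
    exact ⟨_, _, _, _, k, by simp⟩
  refine ⟨p, q, u, w, ?_, by simp⟩
  obtain ⟨h1, h2, h3, h4, h5, h6, h7⟩ := h
  simp only [contract_adj, e1, e2, e3, e4, false_and, or_false, Subtype.ext_iff, ne_eq] at *
  exact ⟨h1.2, h2.2, h3.2, h4.2, h5.2, h6, fun h => h7 ⟨h6, h⟩⟩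

end
-- Compatible relations and the existence of an orientation
/-- An equivalence relation that relates the ends of diamond diagonals, but no two vertices of an
induced `4`-cycle. -/
structure IsCompatible (G : SimpleGraph V) (R : V → V → Prop) : Prop where
  equiv : Equivalence R
  diamond : ∀ {p q u w}, IsInducedDiamond G p q u w → R p q
  side : ∀ {a b c d}, IsInducedC4 G a b c d → ¬ R a b
  diagonal : ∀ {a b c d}, IsInducedC4 G a b c d → ¬ R a c

/-- The map of vertices of the contraction of `y` into `x`. -/
noncomputable def contractMap {x y : V} (hxy : G.Adj x y) (v : V) : {v : V // v ≠ y} :=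
  open Classical in
  if h : v = y then ⟨x, hxy.ne⟩ else ⟨v, h⟩

section

variable {x y : V} (hxy : G.Adj x y)

theorem contractMap_of_ne {v : V} (h : v ≠ y) : contractMap hxy v = ⟨v, h⟩ := by
  simp [contractMap, h]

theorem contractMap_self : contractMap hxy y = ⟨x, hxy.ne⟩ := by
  simp [contractMap]

theorem contractMap_adj {a b : V} (h : G.Adj a b) (hne : contractMap hxy a ≠ contractMap hxy b) :
    (contract G x y).Adj (contractMap hxy a) (contractMap hxy b) := by
  refine ⟨hne, ?_⟩
  by_cases ha : a = y
  · subst ha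
    have hb : b ≠ a := h.ne'
    rw [contractMap_self, contractMap_of_ne hxy hb]
    exact Or.inr (Or.inl ⟨rfl, h⟩)
  · by_cases hb : b = y
    · subst hb
      rw [contractMap_self, contractMap_of_ne hxy ha]
      exact Or.inr (Or.inr ⟨rfl, h⟩)
    · rw [contractMap_of_ne hxy ha, contractMap_of_ne hxy hb]
      exact Or.inl h

variable {R : V → V → Prop}

theorem IsCompatible.rel_contractMap (hR : IsCompatible G R) (h : R x y) (v : V) :
    R (contractMap hxy v).1 v := by
  by_cases hv : v = y
  · subst hv
    rwa [contractMap_self]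
  · rw [contractMap_of_ne hxy hv]
    exact hR.equiv.refl _

/-- Lifted vertices are related to the vertices that they lift, so each condition passes from `G` to
the contraction. -/
theorem IsCompatible.contract (hR : IsCompatible G R) (hr : IsIncomparabilityOrder G r)
    (hxy : G.Adj x y) (h : R x y) : IsCompatible (contract G x y) (fun u w => R u w) := by
  have hC : ¬ IsC4Edge G x y := fun ⟨c, d, k⟩ => hR.side k h
  have lift : ∀ {p' : V} {p : {v : V // v ≠ y}}, (p' = p ∨ (p.1 = x ∧ p' = y)) → R p' p := by
    rintro p' p (rfl | ⟨k, rfl⟩)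
    · exact hR.equiv.refl _
    · rw [k]
      exact hR.equiv.symm h
  have push : ∀ {p' q' : V} {p q : {v : V // v ≠ y}}, R p' p → R q' q → R p q → R p' q' :=
    fun h1 h2 h3 => hR.equiv.trans h1 (hR.equiv.trans h3 (hR.equiv.symm h2))
  refine ⟨⟨fun _ => hR.equiv.refl _, hR.equiv.symm, hR.equiv.trans⟩, ?_, ?_, ?_⟩
  · intro p q u w k
    obtain ⟨p', q', u', w', k, hp, hq⟩ := k.of_contract hxy hC
    exact hR.equiv.trans (hR.equiv.symm (lift hp)) (hR.equiv.trans (hR.diamond k) (lift hq))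
  · intro a b c d k hab
    obtain ⟨a', b', c', d', k, ha, hb, hc, hd⟩ := k.of_contract hr hxy
    exact hR.side k (push (lift ha) (lift hb) hab)
  · intro a b c d k hac
    obtain ⟨a', b', c', d', k, ha, hb, hc, hd⟩ := k.of_contract hr hxy
    exact hR.diagonal k (push (lift ha) (lift hc) hac)

/-- If `z` were adjacent to `c`, then either `b z` would be a diamond diagonal, making `b` related
to `a`, or `z a b c` would be a 4-cycle with a related side. -/
theorem IsCompatible.not_adj_of_isInducedC4 (hR : IsCompatible G R) {z a b c d : V} (hza : R z a)
    (hadj : G.Adj z a) (h : IsInducedC4 G a b c d) : ¬ G.Adj z c := by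
  intro hc
  by_cases hb : G.Adj z b
  · have : IsInducedDiamond G b z a c := ⟨hb.symm, h.ab.symm, h.bc, hadj, hc, h.ne_ac, h.ac⟩
    exact hR.side h (hR.equiv.symm (hR.equiv.trans (hR.diamond this) hza))
  · have hzb : z ≠ b := by
      rintro rfl
      exact hR.side h (hR.equiv.symm hza)
    have : IsInducedC4 G z a b c := ⟨hadj, h.ab, h.bc, hc.symm, hzb, h.ne_ac, hb, h.ac⟩
    exact hR.side this hza

theorem IsCompatible.contractMap_isInducedC4 (hR : IsCompatible G R) (h : R x y)
    {a b c d : V} (k : IsInducedC4 G a b c d) : IsInducedC4 (B0VPG.contract G x y)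
      (contractMap hxy a) (contractMap hxy b) (contractMap hxy c) (contractMap hxy d) := by
  have hne : ∀ {u w}, ¬ R u w → contractMap hxy u ≠ contractMap hxy w := by
    intro u w hn he
    refine hn (hR.equiv.trans (hR.equiv.symm (hR.rel_contractMap hxy h u)) ?_)
    rw [he]
    exact hR.rel_contractMap hxy h w
  have hna : ∀ {a b c d : V}, IsInducedC4 G a b c d →
      ¬ (B0VPG.contract G x y).Adj (contractMap hxy a) (contractMap hxy c) := by
    intro a b c d k hadj
    have hac := k.ac
    have k' := k.rotate.rotate
    have h1 := fun z h1 h2 => hR.not_adj_of_isInducedC4 (z := z) h1 h2 k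
    have h2 := fun z h1 h2 => hR.not_adj_of_isInducedC4 (z := z) h1 h2 k'
    rw [contract_adj] at hadj
    have hs := hR.equiv.symm h
    have sy := hxy.symm
    by_cases ha : a = y
    · subst ha
      have hc := k.ne_ac.symm
      rw [contractMap_self, contractMap_of_ne hxy hc] at hadj
      rcases hadj.2 with e | ⟨-, e⟩ | ⟨e, -⟩
      · exact h1 x h hxy e
      · exact hac e
      · exact hR.diagonal k (by rw [show c = x from e]; exact hs)
    · by_cases hc : c = y
      · subst hc
        rw [contractMap_self, contractMap_of_ne hxy ha] at hadj
        rcases hadj.2 with e | ⟨e, -⟩ | ⟨-, e⟩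
        · exact h2 x h hxy e.symm
        · exact hR.diagonal k (by rw [show a = x from e]; exact h)
        · exact hac e
      · rw [contractMap_of_ne hxy ha, contractMap_of_ne hxy hc] at hadj
        rcases hadj.2 with e | ⟨e, e'⟩ | ⟨e, e'⟩
        · exact hac e
        · obtain rfl : a = x := e
          exact h1 y hs sy e'
        · obtain rfl : c = x := e
          exact h2 y hs sy e'.symm
  exact ⟨contractMap_adj hxy k.ab (hne (hR.side k)),
    contractMap_adj hxy k.bc (hne (hR.side k.rotate)),
    contractMap_adj hxy k.cd (hne (hR.side k.rotate.rotate)),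
    contractMap_adj hxy k.da (hne (hR.side k.rotate.rotate.rotate)),
    hne (hR.diagonal k), hne (hR.diagonal k.rotate), hna k, hna k.rotate⟩

end

/-- In a diamond-free graph the relation identifying just the ends of an edge on no induced
`4`-cycle is compatible. -/
theorem isCompatible_pair {x y : V} (hC : ¬ IsC4Edge G x y) (hxy : G.Adj x y)
    (hd : ∀ p q u w, ¬ IsInducedDiamond G p q u w) :
    IsCompatible G (fun a b => a = b ∨ (a = x ∧ b = y) ∨ (a = y ∧ b = x)) := by
  have hC' : ¬ IsC4Edge G y x := fun ⟨c, d, k⟩ => hC ⟨d, c, k.rotate.reflect⟩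
  refine ⟨⟨fun _ => Or.inl rfl, by grind, by grind⟩, fun h => (hd _ _ _ _ h).elim, ?_, ?_⟩
  · rintro a b c d k (rfl | ⟨rfl, rfl⟩ | ⟨rfl, rfl⟩)
    · exact k.ab.ne rfl
    · exact hC ⟨c, d, k⟩
    · exact hC' ⟨c, d, k⟩
  · rintro a b c d k (rfl | ⟨rfl, rfl⟩ | ⟨rfl, rfl⟩)
    · exact k.ne_ac rfl
    · exact k.ac hxy
    · exact k.ac hxy.symm

/-- The two orientations: adjacent related vertices get the same one, and adjacent vertices of an
induced `4`-cycle get different ones. -/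
theorem exists_orientation (n : ℕ) : ∀ {V : Type u} [Finite V] {G : SimpleGraph V}
    {r R : V → V → Prop}, Nat.card V = n → IsIncomparabilityOrder G r → IsCompatible G R →
    (∀ a₁ a₂ a₃ b₁ b₂ b₃, ¬ IsInducedPrism G a₁ a₂ a₃ b₁ b₂ b₃) →
    ∃ f : V → Bool, (∀ p q, G.Adj p q → R p q → f p = f q) ∧
      ∀ a b, IsC4Edge G a b → f a ≠ f b := by
  induction n with
  | zero =>
    intro V _ G r R hV
    rcases Nat.card_eq_zero.1 hV with h | h
    · exact fun _ _ _ => ⟨fun _ => true, fun p => h.elim p, fun p => h.elim p⟩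
    · exact absurd ‹Finite V› (not_finite_iff_infinite.2 h)
  | succ n ih =>
    intro V _ G r R hV hr hR hp
    -- The relation is kept arbitrary because this is used twice: for the given one, and for the one
    -- that identifies only the ends of an edge on no 4-cycle.
    have step : ∀ {R : V → V → Prop}, IsCompatible G R → ∀ x y, G.Adj x y → R x y →
        ∃ f : V → Bool, (∀ p q, G.Adj p q → R p q → f p = f q) ∧
          ∀ a b, IsC4Edge G a b → f a ≠ f b := by
      intro R hR x y hxy h
      have hC : ¬ IsC4Edge G x y := fun ⟨c, d, k⟩ => hR.side k h
      have hcard : Nat.card {v : V // v ≠ y} = n := by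
        classical
        have := Fintype.ofFinite V
        rw [Nat.card_eq_fintype_card] at hV ⊢
        rw [Fintype.card_subtype_compl, Fintype.card_subtype_eq, hV, Nat.add_sub_cancel]
      obtain ⟨f, hf1, hf2⟩ := ih hcard (contract_isIncomparabilityOrder hr hxy)
        (hR.contract hr hxy h) (by
          intro a₁ a₂ a₃ b₁ b₂ b₃ k
          obtain ⟨a₁, a₂, a₃, b₁, b₂, b₃, k⟩ := k.of_contract hxy hC hr
          exact hp _ _ _ _ _ _ k)
      refine ⟨fun v => f (contractMap hxy v), fun p q hpq hRpq => ?_, ?_⟩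
      · by_cases he : contractMap hxy p = contractMap hxy q
        · exact congrArg f he
        · exact hf1 _ _ (contractMap_adj hxy hpq he) (hR.equiv.trans (hR.rel_contractMap hxy h p)
            (hR.equiv.trans hRpq (hR.equiv.symm (hR.rel_contractMap hxy h q))))
      · rintro a b ⟨c, d, k⟩
        exact hf2 _ _ ⟨_, _, hR.contractMap_isInducedC4 hxy h k⟩
    by_cases h1 : ∃ x y, G.Adj x y ∧ R x y
    · obtain ⟨x, y, hxy, h⟩ := h1
      exact step hR x y hxy h
    push Not at h1
    have hd : ∀ p q u w, ¬ IsInducedDiamond G p q u w :=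
      fun p q u w k => h1 p q k.pq (hR.diamond k)
    by_cases h2 : ∃ x y, G.Adj x y ∧ ¬ IsC4Edge G x y
    · obtain ⟨x, y, hxy, hC⟩ := h2
      obtain ⟨f, -, hf⟩ := step (isCompatible_pair hC hxy hd) x y hxy (by simp)
      exact ⟨f, fun p q hpq h => (h1 p q hpq h).elim, hf⟩
    push Not at h2
    obtain ⟨f, hf⟩ := hr.exists_coloring_of_no_triangle
      (fun a b c hab hbc => hr.no_triangle hd hp h2 hab hbc)
    exact ⟨f, fun p q hpq h => (h1 p q hpq h).elim, fun a b ⟨_, _, k⟩ => hf a b k.ab⟩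

/-! ### Components of equally directed vertices -/

variable {f : V → Bool}

/-- An assignment of directions to the vertices for which diamond diagonals are parallel and the
sides of induced `4`-cycles alternate. -/
structure IsOrientation (G : SimpleGraph V) (f : V → Bool) : Prop where
  diamond : ∀ {p q u w}, IsInducedDiamond G p q u w → f p = f q
  side : ∀ {a b c d}, IsInducedC4 G a b c d → f a ≠ f b

/-- Two vertices are linked if they are joined by a path of equally directed vertices. -/
def Linked (G : SimpleGraph V) (f : V → Bool) : V → V → Prop :=
  Relation.ReflTransGen fun u w => G.Adj u w ∧ f u = f w

theorem Linked.symm {a b : V} (h : Linked G f a b) : Linked G f b a :=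
  (@Relation.ReflTransGen.stdSymm V (fun u w => G.Adj u w ∧ f u = f w)
    ⟨fun _ _ k => ⟨k.1.symm, k.2.symm⟩⟩).symm _ _ h

theorem Linked.trans {a b c : V} (h : Linked G f a b) (k : Linked G f b c) : Linked G f a c :=
  Relation.ReflTransGen.trans h k

theorem Linked.refl (a : V) : Linked G f a a := Relation.ReflTransGen.refl

theorem Linked.of_adj {a b : V} (h : G.Adj a b) (k : f a = f b) : Linked G f a b :=
  Relation.ReflTransGen.single ⟨h, k⟩

theorem Linked.eq {a b : V} (h : Linked G f a b) : f a = f b := by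
  induction h with
  | refl => rfl
  | tail _ k ih => exact ih.trans k.2

theorem Linked.induction {P : V → Prop} {a b : V} (h : Linked G f a b) (ha : P a)
    (hs : ∀ t t', Linked G f a t → Linked G f a t' → f t = f a → f t' = f a → G.Adj t t' →
      P t → P t') : P b := by
  induction h with
  | refl => exact ha
  | @tail t t' h k ih =>
    have hl : Linked G f a t := h
    have hl' := hl.trans (.of_adj k.1 k.2)
    exact hs t t' hl hl' hl.eq.symm hl'.eq.symm k.1 ih

namespace IsOrientation

theorem ne_of_color {a b : V} (h : f a ≠ f b) : a ≠ b := fun k => h (congrArg f k)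

/-- `q` and `p` are comparable neighbours of `v`: what is above `v` is above `q`, and what is below
`v` is below `p`. -/
theorem lt_of_common_neighbour (hf : IsOrientation G f) (hr : IsIncomparabilityOrder G r)
    {q p v t : V} (hqp : r q p) (hq : G.Adj v q) (hp : G.Adj v p)
    (ht : f t = f q) : (r v t → r q t) ∧ (r t v → r t p) := by
  have c1 : ¬ (G.Adj q t ∧ G.Adj t p ∧ ¬ G.Adj t v ∧ t ≠ v) := fun ⟨h1, h2, h3, h4⟩ =>
    hf.side (a := q) (b := t) (c := p) (d := v) ⟨h1, h2, hp.symm, hq,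
      fun h => hr.irrefl _ (h ▸ hqp), h4, fun h => hr.not_lt h hqp, h3⟩ ht.symm
  have t0 := @hr.trans
  have h1 := hr.adj_iff v q
  have h2 := hr.adj_iff v p
  have h3 := hr.adj_iff q t
  have h4 := hr.adj_iff t p
  have h5 := hr.adj_iff t v
  have h6 := hr.irrefl
  grind

/-- The neighbours of `v` in a component of vertices with the other direction form a clique. -/
theorem not_lt_of_linked (hf : IsOrientation G f) (hr : IsIncomparabilityOrder G r) {v h h' : V}
    (h1 : G.Adj v h) (h2 : G.Adj v h') (hc : f v ≠ f h)
    (hl : Linked G f h h') : ¬ r h h' := by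
  intro hlt
  -- Along the component every vertex from `h` on stays below `h'`, which is absurd on arrival at
  -- `h'`.
  refine hr.irrefl h' (hl.induction (P := fun t => r t h') hlt ?_)
  intro t t' _ _ ct ct' htt ih
  have K := @lt_of_common_neighbour V G r f hf hr
  -- Otherwise `t' v` is a diamond diagonal whose ends have different directions.
  have dia : ∀ u, r u h' → G.Adj v u → G.Adj t' u → G.Adj t' v → ¬ G.Adj t' h' :=
    fun u k1 k2 k3 k4 k5 => hc (by
      rw [← ct']
      exact (hf.diamond ⟨k4, k3, k5, k2, h2, fun e => hr.irrefl _ (e ▸ k1),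
        fun e => hr.not_lt e k1⟩).symm)
  have e1 := K hlt h1 h2 ct
  have e2 := K hlt h1 h2 ct'
  have e3 := fun k => K ih k h2 (ct'.trans ct.symm)
  have e4 := fun k1 k2 => @K h t' v t k1 h1 k2 ct
  have d1 := dia h hlt h1
  have d2 := dia t ih
  have n1 : t' ≠ v := ne_of_color (f := f) (by rw [ct']; exact hc.symm)
  have n2 : t ≠ v := ne_of_color (f := f) (by rw [ct]; exact hc.symm)
  have a1 := hr.adj_iff t' h'
  have a2 := hr.adj_iff t t'
  have a3 := hr.adj_iff v t'
  have a4 := hr.adj_iff v t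
  have a5 := hr.adj_iff v h'
  have a6 := hr.adj_iff t' h
  have s1 := G.adj_comm t' v
  have s2 := G.adj_comm t' t
  have t1 := @hr.trans t h' t'
  have t2 := @hr.trans v t h'
  have t3 := @hr.trans t' h h'
  have t4 := @hr.trans t v t'
  have t5 := @hr.trans t t' h'
  grind

/-- If `h` is below `v`, the vertices on the way from `h` to `a` all stay below `v`, against the
adjacency of `a` and `v`. A first `t'` adjacent to `v` would give a diamond with diagonal `t' b`, a
4-cycle with two parallel consecutive vertices, or comparable neighbours of `b` in one component. -/
theorem not_lt_of_adj_of_adj (hf : IsOrientation G f) (hr : IsIncomparabilityOrder G r)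
    {h b v a : V} (hb : G.Adj h b) (hbv : G.Adj b v) (hva : G.Adj v a) (cb : f b = f v)
    (cv : f v ≠ f h) (hl : Linked G f h a) : ¬ r h v := by
  intro hlt
  refine hr.not_gt hva (hl.induction (P := fun t => r t v) hlt ?_)
  intro t t' _ lt' ct ct' htt ih
  by_contra hn
  have nv : t' ≠ v := ne_of_color (f := f) (by rw [ct']; exact cv.symm)
  have nb : t' ≠ b := ne_of_color (f := f) (by rw [ct', cb]; exact cv.symm)
  have nb' : t ≠ b := ne_of_color (f := f) (by rw [ct, cb]; exact cv.symm)
  have hav : G.Adj t' v := (hr.adj_iff _ _).2 ⟨nv, hn, fun k => hr.not_lt htt (hr.trans ih k)⟩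
  have dia : ∀ u, r u v → G.Adj t' u → G.Adj b u → ¬ G.Adj t' b := fun u k1 k2 k3 k4 =>
    cv (by
      rw [← cb, ← ct']
      exact (hf.diamond ⟨k4, k2, hav, k3, hbv, fun e => hr.irrefl _ (e ▸ k1),
        fun e => hr.not_lt e k1⟩).symm)
  have c4 : ∀ u, r u v → f u = f h → G.Adj u t' → G.Adj u b → ¬ G.Adj t' b → False :=
    fun u k1 k2 k3 k4 k5 => hf.side (a := u) (b := t') (c := v) (d := b)
      ⟨k3, hav, hbv.symm, k4.symm, fun e => hr.irrefl _ (e ▸ k1), nb,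
        fun e => hr.not_lt e k1, k5⟩ (k2.trans ct'.symm)
  have d1 := dia h hlt
  have d2 := dia t ih
  have d3 := c4 h hlt rfl
  have d4 := c4 t ih ct
  have e1 := fun k => hf.not_lt_of_linked hr (v := b) hb.symm k (cb.trans_ne cv) lt'
  have e2 := fun k => hf.not_lt_of_linked hr (v := b) k hb.symm
    (by rw [ct', cb]; exact cv) lt'.symm
  have a1 := hr.adj_iff t' h
  have a2 := hr.adj_iff t t'
  have a3 := hr.adj_iff t' b
  have a4 := hr.adj_iff t b
  have a5 := hr.adj_iff h b
  have a6 := hr.adj_iff b v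
  have a7 := hr.adj_iff t' v
  have t1 := @hr.trans b t v
  have t2 := @hr.trans t b t'
  have t3 := @hr.trans h t' b
  have t4 := @hr.trans t' h v
  have s1 := G.adj_comm t' t
  have s2 := G.adj_comm t' h
  have s3 := G.adj_comm t' b
  have s4 := G.adj_comm t b
  have s5 := G.adj_comm h b
  grind

theorem adj_of_adj_of_adj (hf : IsOrientation G f) (hr : IsIncomparabilityOrder G r)
    {h b v a : V} (hb : G.Adj h b) (hbv : G.Adj b v) (hva : G.Adj v a) (cb : f b = f v)
    (cv : f v ≠ f h) (hl : Linked G f h a) : G.Adj h v :=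
  (hr.adj_iff _ _).2 ⟨(ne_of_color cv).symm, hf.not_lt_of_adj_of_adj hr hb hbv hva cb cv hl,
    hf.not_lt_of_adj_of_adj hr.flip hb hbv hva cb cv hl⟩

/-- A component that has vertices below and above `s` has a neighbour of `s`. -/
theorem exists_adj_of_lt_of_lt (hr : IsIncomparabilityOrder G r) {h s a : V} (h1 : r h s)
    (h2 : r s a) (hl : Linked G f h a) (hc : f s ≠ f h) : ∃ t, Linked G f h t ∧ G.Adj t s := by
  by_contra hn
  push Not at hn
  refine hr.irrefl _ (hr.trans h2 (hl.induction (P := fun t => r t s) h1 ?_))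
  intro t t' _ lt' ct ct' htt ih
  rcases hr.trichotomy (ne_of_color (f := f) (by rw [ct']; exact hc.symm)) (hn t' lt') with k | k
  · exact k
  · exact (hr.not_lt htt (hr.trans ih k)).elim

/-- Take a minimal counterexample `t` in the component of `b`. Walking from `b`, the vertices stay
below `t`, which is absurd at `t` itself: a vertex `s` where this stops being true would lie between
`h` and `a`, so it would have a neighbour in their component and be a smaller counterexample. -/
theorem not_lt_of_touching [Finite V] (hf : IsOrientation G f) (hr : IsIncomparabilityOrder G r)
    {h b v a : V} (hb : G.Adj h b) (hbv : Linked G f b v) (hva : G.Adj v a) (cb : f b ≠ f h)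
    (hl : Linked G f h a) : ¬ r h v := by
  intro hlt
  obtain ⟨t, ⟨lt, ht, a, hl, ha⟩, hmin⟩ := hr.flip.exists_maximal
    (fun t => Linked G f b t ∧ r h t ∧ ∃ a, Linked G f h a ∧ G.Adj t a) ⟨v, hbv, hlt, a, hl, hva⟩
  have step := @adj_of_adj_of_adj V G r f hf hr
  refine hr.irrefl t (lt.induction (P := fun s => r s t) ?_ ?_)
  · by_contra hn
    have : G.Adj b t := (hr.adj_iff _ _).2 ⟨by rintro rfl; exact hr.not_lt hb ht, hn,
      fun k => hr.not_lt hb (hr.trans ht k)⟩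
    exact hr.not_lt (step hb this ha lt.eq (lt.eq ▸ cb) hl) ht
  · intro s s' ls ls' cs cs' hss ih
    by_contra hn
    have hst : G.Adj s' t := (hr.adj_iff _ _).2 ⟨by rintro rfl; exact hr.not_lt hss ih, hn,
      fun k => hr.not_lt hss (hr.trans ih k)⟩
    have csh : f s ≠ f h := cs ▸ cb
    have csh' : f s' ≠ f h := cs' ▸ cb
    have hsa : r s a := by
      by_contra hsa
      have : G.Adj a s := (hr.adj_iff _ _).2 ⟨ne_of_color (f := f) (by rw [← hl.eq]; exact csh.symm),
        fun k => hr.not_gt ha (hr.trans k ih), hsa⟩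
      exact hf.not_lt_of_linked hr this ha.symm (by rw [← hl.eq]; exact csh.symm)
        (ls.symm.trans lt) ih
    have hhs : r h s' := by
      by_contra hhs
      have : G.Adj h s' := (hr.adj_iff _ _).2 ⟨(ne_of_color csh').symm, hhs,
        fun k => hn (hr.trans k ht)⟩
      exact hr.not_lt (step this hst ha (cs'.trans lt.eq) (lt.eq ▸ cb) hl) ht
    obtain ⟨a', hl', ha'⟩ : ∃ a', Linked G f h a' ∧ G.Adj a' s' := by
      by_cases k : r s' a
      · exact exists_adj_of_lt_of_lt hr hhs k hl csh'
      · exact ⟨a, hl, (hr.adj_iff _ _).2 ⟨ne_of_color (f := f) (by rw [← hl.eq]; exact csh'.symm),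
          fun k => hr.not_lt hss (hr.trans hsa k), k⟩⟩
    have hhs2 : r h s := by
      by_contra hhs2
      have : G.Adj h s := (hr.adj_iff _ _).2 ⟨(ne_of_color csh).symm, hhs2,
        fun k => hr.not_lt hss (hr.trans k hhs)⟩
      exact hr.not_lt (step this hss ha'.symm (cs.trans cs'.symm) csh' hl') hhs
    obtain ⟨a'', hl'', ha''⟩ := exists_adj_of_lt_of_lt hr hhs2 hsa hl csh
    exact hmin s ⟨ls, hhs2, a'', hl'', ha''.symm⟩ ih

/-- The edges between two components of different directions are all pairs of a vertex with a
neighbour in one component and a vertex with a neighbour in the other. -/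
theorem adj_of_touching [Finite V] (hf : IsOrientation G f) (hr : IsIncomparabilityOrder G r)
    {h b v a : V} (hb : G.Adj h b) (hbv : Linked G f b v) (hva : G.Adj v a) (cb : f b ≠ f h)
    (hl : Linked G f h a) : G.Adj h v :=
  (hr.adj_iff _ _).2 ⟨fun k => cb (hbv.eq.trans (congrArg f k.symm)),
    hf.not_lt_of_touching hr hb hbv hva cb hl,
    hf.not_lt_of_touching hr hva hl.symm hb (by rw [← hl.eq, ← hbv.eq]; exact cb.symm) hbv.symm⟩

end IsOrientation
-- Coordinates of the segments
/-- The component of `v` lies below `u`. -/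
def Below (G : SimpleGraph V) (r : V → V → Prop) (f : V → Bool) (u v : V) : Prop :=
  ∀ w, Linked G f v w → r w u

/-- The component of `v` lies above `u`. -/
def Above (G : SimpleGraph V) (r : V → V → Prop) (f : V → Bool) (u v : V) : Prop :=
  ∀ w, Linked G f v w → r u w

/-- The component of `v` contains a neighbour of `u`. -/
def Touches (G : SimpleGraph V) (f : V → Bool) (u v : V) : Prop :=
  ∃ w, Linked G f v w ∧ G.Adj u w

theorem Below.of_not_linked (hr : IsIncomparabilityOrder G r) {u v : V} (hc : f v = f u)
    (hl : ¬ Linked G f v u) (h : r v u) : Below G r f u v := by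
  intro w hw
  refine hw.induction (P := fun t => r t u) h ?_
  intro t t' lt lt' ct ct' htt ih
  by_contra hn
  have hne : t' ≠ u := fun e => hl (e ▸ lt')
  have : G.Adj t' u := (hr.adj_iff _ _).2 ⟨hne, hn, fun k => hr.not_lt htt (hr.trans ih k)⟩
  exact hl (lt'.trans (.of_adj this (ct'.trans hc)))

theorem Above.of_not_linked (hr : IsIncomparabilityOrder G r) {u v : V} (hc : f v = f u)
    (hl : ¬ Linked G f v u) (h : r u v) : Above G r f u v :=
  Below.of_not_linked hr.flip hc hl h

theorem Below.of_not_touches (hr : IsIncomparabilityOrder G r) {u v : V} (hc : f v ≠ f u)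
    (hl : ¬ Touches G f u v) (h : r v u) : Below G r f u v := by
  intro w hw
  refine hw.induction (P := fun t => r t u) h ?_
  intro t t' lt lt' ct ct' htt ih
  by_contra hn
  have hne : t' ≠ u := fun e => hc (by rw [← ct', e])
  have : G.Adj t' u := (hr.adj_iff _ _).2 ⟨hne, hn, fun k => hr.not_lt htt (hr.trans ih k)⟩
  exact hl ⟨t', lt', this.symm⟩

/-- Along the edges of a component one cannot pass from below `u` to above it without meeting a
neighbour of `u`. -/
theorem not_touches_iff (hr : IsIncomparabilityOrder G r) {u v : V} (hc : f v ≠ f u) :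
    ¬ Touches G f u v ↔ Below G r f u v ∨ Above G r f u v := by
  constructor
  · intro h
    have hv : ¬ G.Adj v u := fun k => h ⟨v, .refl v, k.symm⟩
    rcases hr.trichotomy (fun e => hc (congrArg f e)) hv with k | k
    · exact Or.inl (.of_not_touches hr hc h k)
    · exact Or.inr (Below.of_not_touches hr.flip hc h k)
  · rintro (h | h) ⟨w, hw, k⟩
    · exact hr.not_gt k (h w hw)
    · exact hr.not_lt k (h w hw)

section

variable [Fintype V]

open Classical in
/-- The number of vertices whose component is not above that of `u`: the index of the line of
`u`. -/
noncomputable def lineIndex (G : SimpleGraph V) (r : V → V → Prop) (f : V → Bool) (u : V) : ℕ :=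
  (Finset.univ.filter fun v => f v = f u ∧ (Linked G f v u ∨ r v u)).card

open Classical in
/-- The number of vertices on perpendicular lines below `u`. -/
noncomputable def belowCount (G : SimpleGraph V) (r : V → V → Prop) (f : V → Bool) (u : V) : ℕ :=
  (Finset.univ.filter fun v => f v ≠ f u ∧ Below G r f u v).card

open Classical in
/-- The number of vertices on perpendicular lines not above `u`. -/
noncomputable def notAboveCount (G : SimpleGraph V) (r : V → V → Prop) (f : V → Bool) (u : V) :
    ℕ :=
  (Finset.univ.filter fun v => f v ≠ f u ∧ ¬ Above G r f u v).card

open Classical in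
/-- The left end of `a` in the interval representation of the vertices in its direction. -/
noncomputable def leftEnd (r : V → V → Prop) (f : V → Bool) (a : V) : ℕ :=
  1 + (Finset.univ.filter fun z => f z = f a ∧ r z a).card

open Classical in
/-- The right end of `a` in the interval representation of the vertices in its direction. -/
noncomputable def rightEnd (r : V → V → Prop) (f : V → Bool) (a : V) : ℕ :=
  (Finset.univ.filter fun b => f b = f a ∧ ¬ r a b).sup (leftEnd r f)

theorem lineIndex_eq (hr : IsIncomparabilityOrder G r) {u v : V} (h : Linked G f u v) :
    lineIndex G r f u = lineIndex G r f v := by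
  have key : ∀ {u v}, Linked G f u v → ∀ w, f w = f u ∧ (Linked G f w u ∨ r w u) →
      f w = f v ∧ (Linked G f w v ∨ r w v) := by
    rintro u v h w ⟨h1, h2⟩
    refine ⟨h1.trans h.eq, ?_⟩
    by_cases hl : Linked G f w u
    · exact Or.inl (hl.trans h)
    · exact Or.inr (Above.of_not_linked hr h1.symm (fun k => hl k.symm)
        (h2.resolve_left hl) v h)
  unfold lineIndex
  congr 1
  ext w
  simp only [Finset.mem_filter, Finset.mem_univ, true_and]
  exact ⟨key h w, key h.symm w⟩

theorem lineIndex_lt (hr : IsIncomparabilityOrder G r) {u v : V} (hc : f u = f v)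
    (hl : ¬ Linked G f u v) (h : r u v) : lineIndex G r f u < lineIndex G r f v := by
  classical
  refine Finset.card_lt_card (Finset.ssubset_iff_subset_ne.2 ⟨?_, ?_⟩)
  · intro w hw
    simp only [Finset.mem_filter, Finset.mem_univ, true_and] at hw ⊢
    refine ⟨hw.1.trans hc, ?_⟩
    rcases hw.2 with k | k
    · exact Or.inr (Below.of_not_linked hr hc hl h w k.symm)
    · exact Or.inr (hr.trans k h)
  · intro he
    have : v ∈ Finset.univ.filter fun w => f w = f u ∧ (Linked G f w u ∨ r w u) := by
      rw [he]
      simp [Linked.refl]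
    simp only [Finset.mem_filter, Finset.mem_univ, true_and] at this
    rcases this.2 with k | k
    · exact hl k.symm
    · exact hr.irrefl _ (hr.trans h k)

theorem lineIndex_eq_iff (hr : IsIncomparabilityOrder G r) {u v : V} (hc : f u = f v) :
    lineIndex G r f u = lineIndex G r f v ↔ Linked G f u v := by
  refine ⟨fun h => ?_, lineIndex_eq hr⟩
  by_contra hl
  rcases hr.trichotomy (fun e => hl (by rw [e]; exact .refl _)) (fun k => hl (.of_adj k hc)) with k | k
  · exact (lineIndex_lt hr hc hl k).ne h
  · exact (lineIndex_lt hr hc.symm (fun k => hl k.symm) k).ne h.symm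

/-- Both numbers count initial segments of the linearly ordered perpendicular components, so
comparing them compares the segments. -/
theorem belowCount_lt_lineIndex_iff (hr : IsIncomparabilityOrder G r) {u v : V} (hc : f v ≠ f u) :
    belowCount G r f u < lineIndex G r f v ↔ ¬ Below G r f u v := by
  classical
  have bool : ∀ w, f w ≠ f u ↔ f w = f v := by
    intro w
    revert hc
    cases f w <;> cases f v <;> cases f u <;> simp
  constructor
  · intro h hb
    refine absurd h (not_lt.2 (Finset.card_le_card ?_))
    intro w hw
    simp only [Finset.mem_filter, Finset.mem_univ, true_and] at hw ⊢
    refine ⟨(bool w).2 hw.1, ?_⟩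
    by_cases hl : Linked G f w v
    · exact fun x hx => hb x (hl.symm.trans hx)
    · exact fun x hx => hr.trans (Below.of_not_linked hr hw.1 hl (hw.2.resolve_left hl) x hx)
        (hb v (.refl v))
  · intro hb
    refine Finset.card_lt_card (Finset.ssubset_iff_subset_ne.2 ⟨?_, ?_⟩)
    · intro w hw
      simp only [Finset.mem_filter, Finset.mem_univ, true_and] at hw ⊢
      have hwv := (bool w).1 hw.1
      refine ⟨hwv, ?_⟩
      by_contra hn
      push Not at hn
      rcases hr.trichotomy (fun e => hn.1 (by rw [e]; exact .refl _)) (fun k => hn.1 (.of_adj k hwv)) with k | k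
      · exact hn.2 k
      · exact hb fun x hx => hr.trans (Below.of_not_linked hr hwv.symm (fun k => hn.1 k.symm) k x hx)
          (hw.2 w (.refl w))
    · intro he
      have : v ∈ Finset.univ.filter fun w => f w ≠ f u ∧ Below G r f u w := by
        rw [he]
        simp [Linked.refl]
      simp only [Finset.mem_filter, Finset.mem_univ, true_and] at this
      exact hb this.2

theorem lineIndex_le_notAboveCount_iff (hr : IsIncomparabilityOrder G r) {u v : V}
    (hc : f v ≠ f u) : lineIndex G r f v ≤ notAboveCount G r f u ↔ ¬ Above G r f u v := by
  classical
  have bool : ∀ w, f w ≠ f u ↔ f w = f v := by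
    intro w
    revert hc
    cases f w <;> cases f v <;> cases f u <;> simp
  constructor
  · intro h hb
    refine absurd h (not_le.2 (Finset.card_lt_card (Finset.ssubset_iff_subset_ne.2 ⟨?_, ?_⟩)))
    · intro w hw
      simp only [Finset.mem_filter, Finset.mem_univ, true_and] at hw ⊢
      have hwv := (bool w).1 hw.1
      refine ⟨hwv, ?_⟩
      by_contra hn
      push Not at hn
      rcases hr.trichotomy (fun e => hn.1 (by rw [e]; exact .refl _)) (fun k => hn.1 (.of_adj k hwv)) with k | k
      · exact hn.2 k
      · exact hw.2 fun x hx => hr.trans (hb v (.refl v)) (Above.of_not_linked hr hwv hn.1 k x hx)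
    · intro he
      have : v ∈ Finset.univ.filter fun w => f w ≠ f u ∧ ¬ Above G r f u w := by
        rw [he]
        simp [Linked.refl]
      simp only [Finset.mem_filter, Finset.mem_univ, true_and] at this
      exact this.2 hb
  · intro hb
    refine Finset.card_le_card ?_
    intro w hw
    simp only [Finset.mem_filter, Finset.mem_univ, true_and] at hw ⊢
    refine ⟨(bool w).2 hw.1, fun ha => ?_⟩
    by_cases hl : Linked G f w v
    · exact hb fun x hx => ha x (hl.trans hx)
    · exact hb fun x hx => hr.trans (ha w (.refl w)) (Above.of_not_linked hr hw.1.symm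
        (fun k => hl k.symm) (hw.2.resolve_left hl) x hx)

/-- The summand 1 in `leftEnd` keeps a lower end strictly past the last line below its vertex. -/
theorem leftEnd_pos (a : V) : 0 < leftEnd r f a := by
  unfold leftEnd
  omega

theorem leftEnd_lt (a : V) : leftEnd r f a < Fintype.card V + 2 := by
  classical
  have := Finset.card_le_univ (Finset.univ.filter fun z => f z = f a ∧ r z a)
  unfold leftEnd
  omega

theorem rightEnd_lt (a : V) : rightEnd r f a < Fintype.card V + 2 := by
  unfold rightEnd
  rw [Finset.sup_lt_iff (by simp)]
  exact fun b _ => leftEnd_lt b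

theorem rightEnd_lt_leftEnd_iff (hf : IsOrientation G f) (hr : IsIncomparabilityOrder G r)
    {a b : V} (hc : f b = f a) : rightEnd r f a < leftEnd r f b ↔ r a b := by
  classical
  constructor
  · intro h
    by_contra hn
    refine absurd h (not_lt.2 ?_)
    unfold rightEnd
    exact Finset.le_sup (f := leftEnd r f) (by simp [hc, hn])
  · intro hab
    unfold rightEnd
    rw [Finset.sup_lt_iff (by exact leftEnd_pos b)]
    intro b' hb'
    simp only [Finset.mem_filter, Finset.mem_univ, true_and] at hb'
    unfold leftEnd
    refine Nat.add_lt_add_left (Finset.card_lt_card (Finset.ssubset_iff_subset_ne.2 ⟨?_, ?_⟩)) 1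
    · intro z hz
      simp only [Finset.mem_filter, Finset.mem_univ, true_and] at hz ⊢
      refine ⟨hz.1.trans (hb'.1.trans hc.symm), ?_⟩
      by_contra hn
      -- If `z` is below `b'` but not below `b`, then `a < b` and `z < b'` form a 2+2, an induced
      -- 4-cycle with all vertices parallel.
      have side := fun h1 h2 h3 h4 h5 h6 h7 h8 => hf.side (a := a) (b := z) (c := b) (d := b')
        ⟨h1, h2, h3, h4, h5, h6, h7, h8⟩ (hb'.1.symm.trans hz.1.symm)
      have n := hb'.2
      have hzb := hz.2
      have ir := hr.irrefl
      have t := @hr.trans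
      refine side ?_ ?_ ?_ ?_ ?_ ?_ ?_ ?_ <;> (try rw [hr.adj_iff])
      · refine ⟨?_, ?_, ?_⟩ <;> grind
      · refine ⟨?_, ?_, ?_⟩ <;> grind
      · refine ⟨?_, ?_, ?_⟩ <;> grind
      · refine ⟨?_, ?_, ?_⟩ <;> grind
      · grind
      · grind
      · grind
      · grind
    · intro he
      have : a ∈ Finset.univ.filter fun z => f z = f b' ∧ r z b' := by
        rw [he]
        simp [hab, hc]
      simp only [Finset.mem_filter, Finset.mem_univ, true_and] at this
      exact hb'.2 this.2

/-- The coordinate of the line of `u`. -/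
noncomputable def lineCoord (G : SimpleGraph V) (r : V → V → Prop) (f : V → Bool) (u : V) : ℕ :=
  (Fintype.card V + 2) * lineIndex G r f u

/-- The coordinate of the lower end of `u` on its line. -/
noncomputable def lowerEnd (G : SimpleGraph V) (r : V → V → Prop) (f : V → Bool) (u : V) : ℕ :=
  (Fintype.card V + 2) * belowCount G r f u + leftEnd r f u

/-- The coordinate of the upper end of `u` on its line, up to rounding. -/
noncomputable def upperEnd (G : SimpleGraph V) (r : V → V → Prop) (f : V → Bool) (u : V) : ℕ :=
  (Fintype.card V + 2) * notAboveCount G r f u + rightEnd r f u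

theorem lineCoord_eq_iff (hr : IsIncomparabilityOrder G r) {u v : V} (hc : f u = f v) :
    lineCoord G r f u = lineCoord G r f v ↔ Linked G f u v := by
  rw [← lineIndex_eq_iff hr hc]
  unfold lineCoord
  exact Nat.mul_right_inj (by omega)

theorem mul_add_le_mul_add {N a b c d : ℕ} (h : a ≤ c) (hb : b < N) (h' : a = c → b ≤ d) :
    N * a + b ≤ N * c + d := by
  rcases h.eq_or_lt with rfl | h
  · exact Nat.add_le_add_left (h' rfl) _
  · have := Nat.mul_le_mul_left N (Nat.succ_le_of_lt h)
    rw [Nat.mul_succ] at this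
    omega

theorem lowerEnd_le_upperEnd_iff (hf : IsOrientation G f) (hr : IsIncomparabilityOrder G r)
    {u v : V} (hl : Linked G f u v) : lowerEnd G r f v ≤ upperEnd G r f u ↔ ¬ r u v := by
  have hc := hl.eq.symm
  have bool : ∀ w, f w ≠ f v ↔ f w ≠ f u := fun w => by rw [hc]
  have := Finite.of_fintype V
  constructor
  · intro h hlt
    refine absurd h (not_le.2 ?_)
    have h1 := (rightEnd_lt_leftEnd_iff hf hr hc).2 hlt
    -- No perpendicular line crosses both segments, since some vertex on it would have the
    -- comparable neighbours `u` and `v`. So a line not above `u` is below `v`.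
    have h2 : notAboveCount G r f u ≤ belowCount G r f v := by
      refine Finset.card_le_card fun w hw => ?_
      simp only [Finset.mem_filter, Finset.mem_univ, true_and] at hw ⊢
      refine ⟨(bool w).2 hw.1, ?_⟩
      by_contra hb
      by_cases ht : Touches G f v w
      · obtain ⟨x, hx, hvx⟩ := ht
        have hcx : f x ≠ f u := hx.eq ▸ hw.1
        by_cases ht' : Touches G f u w
        · obtain ⟨y, hy, huy⟩ := ht'
          have hux : G.Adj u x := hf.adj_of_touching hr huy (hy.symm.trans hx) hvx.symm
            (hy.eq ▸ hw.1) hl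
          exact hf.not_lt_of_linked hr hux.symm hvx.symm hcx hl hlt
        · rcases (not_touches_iff hr hw.1).1 ht' with k | k
          · exact hr.not_gt hvx (hr.trans (k x hx) hlt)
          · exact hw.2 k
      · rcases (not_touches_iff hr ((bool w).2 hw.1)).1 ht with k | k
        · exact hb k
        · exact hw.2 fun x hx => hr.trans hlt (k x hx)
    have := Nat.mul_le_mul_left (Fintype.card V + 2) h2
    unfold lowerEnd upperEnd
    omega
  · intro h
    have h1 := mt (rightEnd_lt_leftEnd_iff hf hr hc).1 h
    refine mul_add_le_mul_add ?_ (leftEnd_lt v) fun _ => not_lt.1 h1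
    refine Finset.card_le_card fun w hw => ?_
    simp only [Finset.mem_filter, Finset.mem_univ, true_and] at hw ⊢
    exact ⟨(bool w).1 hw.1, fun k => h (hr.trans (k w (.refl w)) (hw.2 w (.refl w)))⟩

/-- Lines are at multiples of `Fintype.card V + 2` and the offsets of the ends are smaller than
this, so only the indices matter. -/
theorem lineCoord_mem_iff (hr : IsIncomparabilityOrder G r) {u v : V} (hc : f v ≠ f u) :
    (lowerEnd G r f u ≤ lineCoord G r f v ∧ lineCoord G r f v ≤ upperEnd G r f u) ↔
      Touches G f u v := by
  have h1 : lowerEnd G r f u ≤ lineCoord G r f v ↔ belowCount G r f u < lineIndex G r f v := by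
    have h := leftEnd_lt (r := r) (f := f) u
    have h' := leftEnd_pos (r := r) (f := f) u
    unfold lowerEnd lineCoord
    constructor
    · intro k
      by_contra hn
      have := Nat.mul_le_mul_left (Fintype.card V + 2) (not_lt.1 hn)
      omega
    · intro k
      have := mul_add_le_mul_add (d := 0) k.le h (fun e => absurd e k.ne)
      omega
  have h2 : lineCoord G r f v ≤ upperEnd G r f u ↔
      lineIndex G r f v ≤ notAboveCount G r f u := by
    have h := rightEnd_lt (r := r) (f := f) u
    unfold upperEnd lineCoord
    constructor
    · intro k
      by_contra hn
      have := Nat.mul_le_mul_left (Fintype.card V + 2) (Nat.succ_le_of_lt (not_le.1 hn))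
      rw [Nat.mul_succ] at this
      omega
    · intro k
      have := Nat.mul_le_mul_left (Fintype.card V + 2) k
      omega
  rw [h1, h2, belowCount_lt_lineIndex_iff hr hc, lineIndex_le_notAboveCount_iff hr hc,
    ← not_or, ← not_touches_iff hr hc, not_not]

theorem adj_iff_touches (hf : IsOrientation G f) (hr : IsIncomparabilityOrder G r) {u v : V}
    (hc : f v ≠ f u) : G.Adj u v ↔ Touches G f u v ∧ Touches G f v u := by
  have := Finite.of_fintype V
  constructor
  · exact fun h => ⟨⟨v, .refl v, h⟩, u, .refl u, h.symm⟩
  · rintro ⟨⟨b, hb, hub⟩, a, ha, hva⟩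
    exact hf.adj_of_touching hr hub hb.symm hva (hb.eq ▸ hc) ha

end

/-- Lengthening by one half makes all segments nondegenerate without changing any comparison of
integer coordinates. -/
theorem cast_le_cast_add_half {m n : ℕ} : (m : ℝ) ≤ (n : ℝ) + 1 / 2 ↔ m ≤ n := by
  constructor
  · intro h
    by_contra hn
    have : (n : ℝ) + 1 ≤ m := by exact_mod_cast Nat.succ_le_of_lt (not_le.1 hn)
    linarith
  · intro h
    have : (m : ℝ) ≤ n := by exact_mod_cast h
    linarith

theorem isB0VPG_of_isOrientation [Finite V] (hf : IsOrientation G f)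
    (hr : IsIncomparabilityOrder G r) : IsB0VPG G := by
  have := Fintype.ofFinite V
  set I : V → Set ℝ := fun u => Set.Icc (lowerEnd G r f u : ℝ) (upperEnd G r f u + 1 / 2) with hI
  set c : V → ℝ := fun u => (lineCoord G r f u : ℝ) with hcd
  have hlt : ∀ u, (lowerEnd G r f u : ℝ) < upperEnd G r f u + 1 / 2 := by
    intro u
    have : (lowerEnd G r f u : ℝ) ≤ upperEnd G r f u := by
      exact_mod_cast (lowerEnd_le_upperEnd_iff hf hr (.refl u)).2 (hr.irrefl u)
    linarith
  have par : ∀ u v, f u = f v → u ≠ v → (G.Adj u v ↔ c u = c v ∧ (I u ∩ I v).Nonempty) := by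
    intro u v hc hne
    simp only [hI, hcd, Set.Icc_inter_Icc, Set.nonempty_Icc, Nat.cast_inj, sup_le_iff, le_inf_iff]
    simp only [cast_le_cast_add_half]
    rw [lineCoord_eq_iff hr hc]
    constructor
    · intro h
      have hl : Linked G f u v := .of_adj h hc
      refine ⟨hl, ⟨?_, ?_⟩, ?_, ?_⟩
      · exact (lowerEnd_le_upperEnd_iff hf hr (.refl u)).2 (hr.irrefl u)
      · exact (lowerEnd_le_upperEnd_iff hf hr hl).2 (hr.not_lt h)
      · exact (lowerEnd_le_upperEnd_iff hf hr hl.symm).2 (hr.not_gt h)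
      · exact (lowerEnd_le_upperEnd_iff hf hr (.refl v)).2 (hr.irrefl v)
    · rintro ⟨hl, ⟨-, h2⟩, h1, -⟩
      exact (hr.adj_iff _ _).2 ⟨hne, (lowerEnd_le_upperEnd_iff hf hr hl).1 h2,
        (lowerEnd_le_upperEnd_iff hf hr hl.symm).1 h1⟩
  have perp : ∀ u v, f v ≠ f u → (G.Adj u v ↔ c v ∈ I u ∧ c u ∈ I v) := by
    intro u v hc
    simp only [hI, hcd, Set.mem_Icc, Nat.cast_le, cast_le_cast_add_half]
    rw [lineCoord_mem_iff hr hc, lineCoord_mem_iff hr hc.symm, adj_iff_touches hf hr hc]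
  refine ⟨fun u => if f u then I u ×ˢ {c u} else {c u} ×ˢ I u, fun u => ?_, fun u v hne => ?_⟩
  · cases hu : f u
    · exact Or.inr ⟨c u, _, _, hlt u, by simp only [hu, Bool.false_eq_true, if_false, hI]⟩
    · exact Or.inl ⟨_, _, c u, hlt u, by simp only [hu, if_true, hI]⟩
  · cases hu : f u <;> cases hv : f v
    · rw [par u v (hu.trans hv.symm) hne]
      simp only [hu, hv, Bool.false_eq_true, if_false, Set.prod_inter_prod, Set.prod_nonempty_iff,
        Set.singleton_inter_nonempty, Set.mem_singleton_iff]
    · rw [perp u v (by simp [hu, hv])]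
      simp only [hu, hv, Bool.false_eq_true, if_false, if_true, Set.prod_inter_prod, Set.prod_nonempty_iff,
        Set.singleton_inter_nonempty, Set.inter_singleton_nonempty]
      exact and_comm
    · rw [perp u v (by simp [hu, hv])]
      simp only [hu, hv, Bool.false_eq_true, if_false, if_true, Set.prod_inter_prod, Set.prod_nonempty_iff,
        Set.singleton_inter_nonempty, Set.inter_singleton_nonempty]
    · rw [par u v (hu.trans hv.symm) hne]
      simp only [hu, hv, if_true, Set.prod_inter_prod, Set.prod_nonempty_iff,
        Set.singleton_inter_nonempty, Set.mem_singleton_iff]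
      exact and_comm

/-! ### Embeddings of the small graphs as explicit configurations -/

theorem cycleGraph_four_adj (i j : Fin 4) :
    (SimpleGraph.cycleGraph 4).Adj i j ↔ i ≠ j ∧ i ≠ j + 2 := by
  rw [SimpleGraph.cycleGraph_adj]
  revert i j
  decide

theorem diamond_adj (i j : Fin 4) :
    diamond.Adj i j ↔ i ≠ j ∧ ¬ (i = 1 ∧ j = 3) ∧ ¬ (i = 3 ∧ j = 1) := by
  simp only [diamond, SimpleGraph.sup_adj, SimpleGraph.cycleGraph_adj, SimpleGraph.edge_adj]
  revert i j
  decide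

theorem compl_cycleGraph_six_adj (i j : Fin 6) :
    (SimpleGraph.cycleGraph 6)ᶜ.Adj i j ↔ i ≠ j ∧ i ≠ j + 1 ∧ j ≠ i + 1 := by
  rw [SimpleGraph.compl_adj, SimpleGraph.cycleGraph_adj]
  revert i j
  decide

theorem isInducedC4_of_embedding (φ : SimpleGraph.cycleGraph 4 ↪g G) :
    IsInducedC4 G (φ 0) (φ 1) (φ 2) (φ 3) := by
  constructor <;> simp [cycleGraph_four_adj]

theorem IsInducedC4.exists_embedding {a b c d : V} (h : IsInducedC4 G a b c d) :
    ∃ φ : SimpleGraph.cycleGraph 4 ↪g G, φ 0 = a ∧ φ 1 = b ∧ φ 2 = c ∧ φ 3 = d := by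
  have h1 := h.ab
  have h2 := h.bc
  have h3 := h.cd
  have h4 := h.da
  have h5 := h.ac
  have h6 := h.bd
  have h7 := h.ne_ac
  have h8 := h.ne_bd
  have s5 : ¬ G.Adj c a := fun k => h5 k.symm
  have s6 : ¬ G.Adj d b := fun k => h6 k.symm
  refine ⟨⟨⟨![a, b, c, d], ?_⟩, ?_⟩, rfl, rfl, rfl, rfl⟩
  · intro i j
    fin_cases i <;> fin_cases j <;>
      simp [h1.ne, h2.ne, h3.ne, h4.ne, h1.ne', h2.ne', h3.ne', h4.ne', h7, h8, h7.symm, h8.symm]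
  · intro i j
    change G.Adj (![a, b, c, d] i) (![a, b, c, d] j) ↔ _
    fin_cases i <;> fin_cases j <;>
      simp [cycleGraph_four_adj, h1, h2, h3, h4, h1.symm, h2.symm, h3.symm, h4.symm, h5, h6, s5, s6]

theorem isDiamondDiagonal_iff {p q : V} :
    IsDiamondDiagonal G p q ↔ ∃ u w, IsInducedDiamond G p q u w := by
  constructor
  · rintro ⟨φ, rfl, rfl⟩
    refine ⟨φ 1, φ 3, ?_⟩
    constructor <;> simp [diamond_adj]
  · rintro ⟨u, w, h⟩
    have h1 := h.pq
    have h2 := h.pu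
    have h3 := h.pw
    have h4 := h.qu
    have h5 := h.qw
    have h6 := h.ne_uw
    have h7 := h.uw
    have s7 : ¬ G.Adj w u := fun k => h7 k.symm
    refine ⟨⟨⟨![p, u, q, w], ?_⟩, ?_⟩, rfl, rfl⟩
    · intro i j
      fin_cases i <;> fin_cases j <;>
        simp [h1.ne, h2.ne, h3.ne, h4.ne, h5.ne, h1.ne', h2.ne', h3.ne', h4.ne', h5.ne', h6,
          h6.symm]
    · intro i j
      change G.Adj (![p, u, q, w] i) (![p, u, q, w] j) ↔ _
      fin_cases i <;> fin_cases j <;>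
        simp [diamond_adj, h1, h2, h3, h4, h5, h1.symm, h2.symm, h3.symm, h4.symm, h5.symm, h7, s7]

theorem isIndContained_iff_exists_prism :
    (SimpleGraph.cycleGraph 6)ᶜ.IsIndContained G ↔
      ∃ a₁ a₂ a₃ b₁ b₂ b₃, IsInducedPrism G a₁ a₂ a₃ b₁ b₂ b₃ := by
  constructor
  · rintro ⟨φ⟩
    -- In the complement of the 6-cycle the even and the odd vertices form the triangles, and `i` is
    -- matched with `i + 3`.
    refine ⟨φ 0, φ 2, φ 4, φ 3, φ 5, φ 1, ?_⟩
    constructor <;>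
      simp only [ne_eq, φ.map_adj_iff, φ.injective.eq_iff, compl_cycleGraph_six_adj] <;> decide
  · rintro ⟨a₁, a₂, a₃, b₁, b₂, b₃, h⟩
    obtain ⟨h1, h2, h3, h4, h5, h6, h7, h8, h9, n1, n2, n3, n4, n5, n6, m1, m2, m3, m4, m5, m6⟩ := h
    have s := G.adj_comm
    refine ⟨⟨⟨![a₁, b₃, a₂, b₁, a₃, b₂], ?_⟩, ?_⟩⟩
    · intro i j
      fin_cases i <;> fin_cases j <;>
        simp [h1.ne, h2.ne, h3.ne, h4.ne, h5.ne, h6.ne, h7.ne, h8.ne, h9.ne, h1.ne', h2.ne', h3.ne',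
          h4.ne', h5.ne', h6.ne', h7.ne', h8.ne', h9.ne', n1, n2, n3, n4, n5, n6, n1.symm, n2.symm,
          n3.symm, n4.symm, n5.symm, n6.symm]
    · intro i j
      change G.Adj (![a₁, b₃, a₂, b₁, a₃, b₂] i) (![a₁, b₃, a₂, b₁, a₃, b₂] j) ↔ _
      rw [compl_cycleGraph_six_adj]
      fin_cases i <;> fin_cases j <;>
        simp [h1, h2, h3, h4, h5, h6, h7, h8, h9, h1.symm, h2.symm, h3.symm,
          h4.symm, h5.symm, h6.symm, h7.symm, h8.symm, h9.symm, m1, m2, m3, m4, m5, m6,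
          s b₂ a₁, s b₃ a₁, s b₁ a₂, s b₃ a₂, s b₁ a₃, s b₂ a₃]

/-! ### Necessity: lines and directions in a segment representation -/

/-- Segments in coordinates: `f` tells the direction, `c` is the coordinate of the line, and the
segment extends from `l` to `m` on it. -/
structure IsSegmentRepresentation (G : SimpleGraph V) (f : V → Bool) (c l m : V → ℝ) : Prop where
  le : ∀ v, l v ≤ m v
  parallel : ∀ {u v}, u ≠ v → f u = f v → (G.Adj u v ↔ c u = c v ∧ l u ≤ m v ∧ l v ≤ m u)
  perpendicular : ∀ {u v}, f u ≠ f v →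
    (G.Adj u v ↔ (l u ≤ c v ∧ c v ≤ m u) ∧ l v ≤ c u ∧ c u ≤ m v)

theorem IsB0VPG.exists_segmentRepresentation (h : IsB0VPG G) :
    ∃ f c l m, IsSegmentRepresentation G f c l m := by
  obtain ⟨S, hS, hadj⟩ := h
  have : ∀ v, ∃ (f : Bool) (c l m : ℝ), l ≤ m ∧
      S v = if f then Set.Icc l m ×ˢ {c} else {c} ×ˢ Set.Icc l m := by
    intro v
    rcases hS v with ⟨a, b, y, hab, h⟩ | ⟨x, a, b, hab, h⟩
    · exact ⟨true, y, a, b, hab.le, by simpa using h⟩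
    · exact ⟨false, x, a, b, hab.le, by simpa using h⟩
  choose f c l m hlm hS using this
  refine ⟨f, c, l, m, hlm, ?_, ?_⟩
  · intro u v hne hc
    have hu := hlm u
    have hv := hlm v
    rw [hadj u v hne, hS, hS, ← hc]
    cases f u <;>
      simp only [Bool.false_eq_true, if_false, if_true, Set.prod_inter_prod, Set.prod_nonempty_iff,
        Set.singleton_inter_nonempty, Set.mem_singleton_iff, Set.Icc_inter_Icc, Set.nonempty_Icc,
        sup_le_iff, le_inf_iff] <;> tauto
  · intro u v hc
    rw [hadj u v (fun e => hc (congrArg f e)), hS, hS]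
    cases hu : f u <;> cases hv : f v
    · exact absurd (hu.trans hv.symm) hc
    · simp only [Bool.false_eq_true, if_false, if_true, Set.prod_inter_prod, Set.prod_nonempty_iff,
        Set.singleton_inter_nonempty, Set.inter_singleton_nonempty, Set.mem_Icc]
      tauto
    · simp only [Bool.false_eq_true, if_false, if_true, Set.prod_inter_prod, Set.prod_nonempty_iff,
        Set.singleton_inter_nonempty, Set.inter_singleton_nonempty, Set.mem_Icc]
    · exact absurd (hu.trans hv.symm) hc

namespace IsSegmentRepresentation

variable {c l m : V → ℝ}

theorem coord_eq (h : IsSegmentRepresentation G f c l m) {u v : V} (hc : f u = f v)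
    (huv : G.Adj u v) : c u = c v :=
  ((h.parallel huv.ne hc).1 huv).1

/-- Collinear segments that meet a common perpendicular segment meet each other. -/
theorem adj_of_perpendicular (h : IsSegmentRepresentation G f c l m) {u v w : V} (hne : u ≠ v)
    (hc : f u = f v) (hw : f u ≠ f w) (hcol : c u = c v) (hu : G.Adj u w) (hv : G.Adj v w) :
    G.Adj u v := by
  have h1 := (h.perpendicular hw).1 hu
  have h2 := (h.perpendicular (hc ▸ hw)).1 hv
  exact (h.parallel hne hc).2 ⟨hcol, h1.1.1.trans h2.1.2, h2.1.1.trans h1.1.2⟩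

/-- Parallel `p` and `q` are collinear. If all four segments are parallel they are intervals of one
line, which form no induced 4-cycle; in the other cases a diagonal is forced to be an edge. -/
theorem side (h : IsSegmentRepresentation G f c l m) {p q s t : V} (hC : IsInducedC4 G p q s t) :
    f p ≠ f q := by
  intro hpq
  have epq := h.coord_eq hpq hC.ab
  by_cases hps : f p = f s
  · have eqs := h.coord_eq (hpq.symm.trans hps) hC.bc
    by_cases hpt : f p = f t
    · have h1 := (h.parallel hC.ab.ne hpq).1 hC.ab
      have h2 := (h.parallel hC.bc.ne (hpq.symm.trans hps)).1 hC.bc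
      have h3 := (h.parallel hC.cd.ne (hps.symm.trans hpt)).1 hC.cd
      have h4 := (h.parallel hC.da.ne hpt.symm).1 hC.da
      have h5 := mt (h.parallel hC.ne_ac hps).2 hC.ac
      have h6 := mt (h.parallel hC.ne_bd (hpq.symm.trans hpt)).2 hC.bd
      have h7 := h.le p
      have h8 := h.le q
      have h9 := h.le s
      have h10 := h.le t
      grind
    · exact hC.ac (h.adj_of_perpendicular hC.ne_ac hps hpt (epq.trans eqs) hC.da.symm hC.cd)
  · by_cases hpt : f p = f t
    · exact hC.bd (h.adj_of_perpendicular hC.ne_bd (hpq.symm.trans hpt) (hpq ▸ hps)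
        (epq.symm.trans (h.coord_eq hpt hC.da.symm)) hC.bc hC.cd.symm)
    · have hst : f s = f t := by
        revert hps hpt
        cases f p <;> cases f s <;> cases f t <;> simp
      have est := h.coord_eq hst hC.cd
      have h1 := (h.perpendicular (hpq ▸ hps)).1 hC.bc
      have h2 := (h.perpendicular hpt).1 hC.da.symm
      refine hC.ac ((h.perpendicular hps).2 ⟨?_, ?_⟩)
      · rw [est]
        exact h2.1
      · rw [epq]
        exact h1.2

theorem diagonal (h : IsSegmentRepresentation G f c l m) {p q s t : V}
    (hC : IsInducedC4 G p q s t) (hc : f p = f s) : c p ≠ c s := fun e =>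
  hC.ac (h.adj_of_perpendicular hC.ne_ac hc (h.side hC) e hC.ab hC.bc.symm)

/-- If `p` and `q` were perpendicular, every common neighbour would be collinear with one of them
and meet the other, hence contain their crossing point. Then `s` and `t` would meet. -/
theorem diamond (h : IsSegmentRepresentation G f c l m) {p q s t : V}
    (hD : IsInducedDiamond G p q s t) : f p = f q ∧ c p = c q := by
  suffices hpq : f p = f q from ⟨hpq, h.coord_eq hpq hD.pq⟩
  by_contra hpq
  have h0 := (h.perpendicular hpq).1 hD.pq
  have key : ∀ u, G.Adj p u → G.Adj q u →
      (f u = f p ∧ c u = c p ∧ l u ≤ c q ∧ c q ≤ m u) ∨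
      (f u = f q ∧ c u = c q ∧ l u ≤ c p ∧ c p ≤ m u) := by
    intro u hp hq
    by_cases hu : f p = f u
    · have h1 := h.coord_eq hu hp
      have h2 := (h.perpendicular (fun e => hpq (hu.trans e.symm))).1 hq
      exact Or.inl ⟨hu.symm, h1.symm, h2.2⟩
    · have hu' : f q = f u := by
        revert hu hpq
        cases f p <;> cases f q <;> cases f u <;> simp
      have h1 := h.coord_eq hu' hq
      have h2 := (h.perpendicular hu).1 hp
      exact Or.inr ⟨hu'.symm, h1.symm, h2.2⟩
  refine hD.uw ?_
  rcases key s hD.pu hD.qu with ⟨a1, a2, a3, a4⟩ | ⟨a1, a2, a3, a4⟩ <;>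
    rcases key t hD.pw hD.qw with ⟨b1, b2, b3, b4⟩ | ⟨b1, b2, b3, b4⟩
  · exact (h.parallel hD.ne_uw (a1.trans b1.symm)).2
      ⟨a2.trans b2.symm, a3.trans b4, b3.trans a4⟩
  · exact (h.perpendicular (by rwa [a1, b1])).2 ⟨by rw [b2]; exact ⟨a3, a4⟩, by rw [a2]; exact ⟨b3, b4⟩⟩
  · exact (h.perpendicular (by rw [a1, b1]; exact fun e => hpq e.symm)).2
      ⟨by rw [b2]; exact ⟨a3, a4⟩, by rw [a2]; exact ⟨b3, b4⟩⟩
  · exact (h.parallel hD.ne_uw (a1.trans b1.symm)).2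
      ⟨a2.trans b2.symm, a3.trans b4, b3.trans a4⟩

theorem of_diamondRelated (h : IsSegmentRepresentation G f c l m) {p q : V}
    (hD : DiamondRelated G p q) : f p = f q ∧ c p = c q := by
  obtain ⟨w, -, hw⟩ := hD
  induction w with
  | nil => exact ⟨rfl, rfl⟩
  | @cons p q s hpq w ih =>
    obtain ⟨u, t, hd⟩ := isDiamondDiagonal_iff.1 (hw p q (by simp))
    have h1 := h.diamond hd
    have h2 := ih fun u v huv => hw u v (by simp [huv])
    exact ⟨h1.1.trans h2.1, h1.2.trans h2.2⟩

end IsSegmentRepresentation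

/-! ### Diamond paths, orders and the final equivalence -/

theorem IsDiamondDiagonal.symm {p q : V} (h : IsDiamondDiagonal G p q) :
    IsDiamondDiagonal G q p := by
  rw [isDiamondDiagonal_iff] at h ⊢
  obtain ⟨u, w, h⟩ := h
  exact ⟨u, w, h.swap⟩

theorem diamondRelated_of_reflTransGen {p q : V}
    (h : Relation.ReflTransGen (IsDiamondDiagonal G) p q) : DiamondRelated G p q := by
  classical
  suffices H : ∃ w : G.Walk p q, ∀ u v : V, s(u, v) ∈ w.edges → IsDiamondDiagonal G u v by
    obtain ⟨w, hw⟩ := H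
    exact ⟨w.bypass, w.bypass_isPath, fun u v huv => hw u v (w.edges_bypass_subset_edges huv)⟩
  induction h using Relation.ReflTransGen.head_induction_on with
  | refl => exact ⟨.nil, by simp⟩
  | @head a b h _ ih =>
    obtain ⟨w, hw⟩ := ih
    obtain ⟨u, t, hd⟩ := isDiamondDiagonal_iff.1 h
    refine ⟨.cons hd.pq w, fun x y hxy => ?_⟩
    rw [SimpleGraph.Walk.edges_cons, List.mem_cons] at hxy
    rcases hxy with k | k
    · rcases Sym2.eq_iff.1 k with ⟨rfl, rfl⟩ | ⟨rfl, rfl⟩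
      · exact h
      · exact h.symm
    · exact hw x y k

theorem IsCocomparabilityGraph.exists_order (h : IsCocomparabilityGraph G) :
    ∃ r, IsIncomparabilityOrder G r := by
  obtain ⟨P, hP⟩ := h
  refine ⟨P.lt, fun a => lt_irrefl a, fun h k => lt_trans h k, fun a b => ?_⟩
  have h1 := hP a b
  rw [SimpleGraph.compl_adj] at h1
  have h2 : P.lt a b ↔ P.le a b ∧ a ≠ b := lt_iff_le_and_ne
  have h3 : P.lt b a ↔ P.le b a ∧ b ≠ a := lt_iff_le_and_ne
  have h4 : G.Adj a b → a ≠ b := fun k => k.ne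
  have h5 : b ≠ a ↔ a ≠ b := ne_comm
  tauto

end B0VPG

theorem theorem1 {V : Type*} [Finite V] (G : SimpleGraph V)
    (hG : B0VPG.IsCocomparabilityGraph G) :
    B0VPG.IsB0VPG G ↔
      (∀ f : SimpleGraph.cycleGraph 4 ↪g G, ∀ i j : Fin 4, i ≠ j →
        ¬ B0VPG.DiamondRelated G (f i) (f j)) ∧
      ¬ (SimpleGraph.cycleGraph 6)ᶜ.IsIndContained G := by
  open B0VPG in
  constructor
  · intro h
    obtain ⟨f, c, l, m, hS⟩ := h.exists_segmentRepresentation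
    refine ⟨fun φ i j hij hD => ?_, fun hp => ?_⟩
    · have hC := isInducedC4_of_embedding φ
      obtain ⟨h1, h2⟩ := hS.of_diamondRelated hD
      have a1 := hS.side hC
      have a2 := hS.side hC.rotate
      have a3 := hS.side hC.rotate.rotate
      have a4 := hS.side hC.rotate.rotate.rotate
      have d1 := hS.diagonal hC
      have d2 := hS.diagonal hC.rotate
      fin_cases i <;> fin_cases j <;> simp_all
    · obtain ⟨a₁, a₂, a₃, b₁, b₂, b₃, h⟩ := isIndContained_iff_exists_prism.1 hp
      -- With the rotations of the prism this asks for three pairwise different values in `Bool`.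
      have key : ∀ {a₁ a₂ a₃ b₁ b₂ b₃ : V}, IsInducedPrism G a₁ a₂ a₃ b₁ b₂ b₃ → f a₁ ≠ f a₂ :=
        fun h => hS.side ⟨h.a₁a₂, h.a₂b₂, h.b₁b₂.symm, h.a₁b₁.symm, h.ne₁₂, h.ne₂₁, h.a₁b₂, h.a₂b₁⟩
      have h1 := key h
      have h2 := key h.rotate
      have h3 := key h.rotate.rotate
      revert h1 h2 h3
      cases f a₁ <;> cases f a₂ <;> cases f a₃ <;> simp
  · rintro ⟨h1, h2⟩
    obtain ⟨r, hr⟩ := hG.exists_order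
    have hR : IsCompatible G (Relation.ReflTransGen (IsDiamondDiagonal G)) := by
      refine ⟨⟨fun _ => .refl, fun h => ?_, fun h k => h.trans k⟩, fun h => ?_, fun h k => ?_,
        fun h k => ?_⟩
      · exact (@Relation.ReflTransGen.stdSymm V (IsDiamondDiagonal G)
          ⟨fun _ _ k => k.symm⟩).symm _ _ h
      · exact .single (isDiamondDiagonal_iff.2 ⟨_, _, h⟩)
      · obtain ⟨φ, rfl, rfl, -, -⟩ := h.exists_embedding
        exact h1 φ 0 1 (by decide) (diamondRelated_of_reflTransGen k)
      · obtain ⟨φ, rfl, -, rfl, -⟩ := h.exists_embedding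
        exact h1 φ 0 2 (by decide) (diamondRelated_of_reflTransGen k)
    obtain ⟨f, hf1, hf2⟩ := exists_orientation (Nat.card V) rfl hr hR
      fun a₁ a₂ a₃ b₁ b₂ b₃ h => h2 (isIndContained_iff_exists_prism.2 ⟨_, _, _, _, _, _, h⟩)
    exact isB0VPG_of_isOrientation
      ⟨fun h => hf1 _ _ h.pq (hR.diamond h), fun h => hf2 _ _ ⟨_, _, h⟩⟩ hr
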